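/- Let $\mathbb{C}^{\mathbb{N}}$ be the space of all complex sequences with the product topology. For a complex Hausdorff locally convex space $E$ let $\mathcal{H}(E)$ be the vector space of all holomorphic functions $f\colon E\to\mathbb{C}$, i.e. the continuous functions whose restriction to each complex affine line is holomorphic. On $\mathcal{H}(E)$ consider three topologies: - $\tau_0$, the compact-open topology; - $\tau_\omega$, generated by all seminorms $q$ ported by some compact $K\subset E$, i.e. such that for each open $V\supset K$ there is $C>0$ with $q(f)\le C\sup_V|f|$ for all $f\in\mathcal{H}(E)$; - $\tau_\delta$, generated by all seminorms $q$ such that for each increasing countable open cover $(V_n)$ of $E$ there are $n$ and $C>0$ with $q(f)\le C\sup_{V_n}|f|$ for all $f\in\mathcal{H}(E)$. For a normed space $X$, a function $g\in \mathcal{H}(X)$ has $m$-th derivative at $0$ the continuous $m$-homogeneous polynomial $\hat d^m g(0)=m!\,P_m$, where $g=\sum_m P_m$ uniformly on some ball centred at $0$. Let $\mathcal{H}_b(X)$ be the space of all $g\in\mathcal{H}(X)$ with $\lim_{m}\big(\tfrac1{m!}\|\hat d^m g(0)\|\big)^{1/m}=0$, where $\|\cdot\|$ is the supremum over the closed unit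 ball, endowed with the topology generated by the seminorms $\|g\|_\rho=\sum_{m\ge0}\frac{\rho^m}{m!}\|\hat d^m g(0)\|$, $\rho>0$. For a continuous seminorm $p$ on $E$ let $E_p=(E,p)/p^{-1}(0)$, with canonical map $\pi_p\colon E\to E_p$. Let $\mathcal{H}_{ub}(E)\subset\mathcal{H}(E)$ be the space of all functions $g\circ\pi_p$ with $p$ a continuous seminorm on $E$ and $g\in\mathcal{H}_b(E_p)$, endowed with the finest locally convex topology for which all the maps $\mathcal{H}_b(E_p)\to\mathcal{H}_{ub}(E)$, $g\mapsto g\circ\pi_p$, are continuous. For $a\in E$ let $(\tau_a f)(x)=f(x-a)$. A convolution operator on $(\mathcal{H}(E),\tau)$ is a $\tau$-continuous linear map $L\colon\mathcal{H}(E)\to\mathcal{H}(E)$ with $L\tau_b=\tau_bL$ for all $b\in E$. A continuous linear operator $T$ is hypercyclic if some orbit $\{f,Tf,T^2f,\dots\}$ is dense. **Theorem.** (a) $(\mathcal{H}(\mathbb{C}^{\mathbb{N}}),\tau_0)=(\mathcal{H}(\mathbb{C}^{\mathbb{N}}),\tau_\omega)\neq(\mathcal{H}(\mathbb{C}^{\mathbb{N}}),\tau_\delta)=\mathcal{H}_{ub}(\mathbb{C}^{\mathbb{N}})$,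 where the last equality holds algebraically and topologically. (b) For each $a\in\mathbb{C}^{\mathbb{N}}$, the translation operator $\tau_a$ is a convolution operator on $(\mathcal{H}(\mathbb{C}^{\mathbb{N}}),\tau)$ which is not hypercyclic, for $\tau=\tau_0$, $\tau_\omega$ and $\tau_\delta$. -/

import Mathlib

open Filter Topology Set

noncomputable section

namespace HolC

/-! ### Holomorphic functions on a complex locally convex space -/

section Holo

variable (E : Type*) [AddCommGroup E] [Module ℂ E] [TopologicalSpace E]

/-- The linear space of functions `E → ℂ` which are holomorphic on `E`, that is, continuous and
Gâteaux holomorphic (holomorphic along every complex affine line). -/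
def holoSubmodule : Submodule ℂ (E → ℂ) where
  carrier := {f | Continuous f ∧ ∀ a b : E, Differentiable ℂ fun z : ℂ => f (a + z • b)}
  add_mem' := fun hf hg => ⟨hf.1.add hg.1, fun a b => (hf.2 a b).add (hg.2 a b)⟩
  zero_mem' := ⟨continuous_const, fun _ _ => differentiable_const _⟩
  smul_mem' := fun c _ hf => ⟨hf.1.const_smul c, fun a b => (hf.2 a b).const_smul c⟩

/-- The space `H(E)`; it is a type of its own, so that it carries no default topology. -/
def Holo : Type _ := holoSubmodule E

instance : AddCommGroup (Holo E) := inferInstanceAs (AddCommGroup (holoSubmodule E))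

instance : Module ℂ (Holo E) := inferInstanceAs (Module ℂ (holoSubmodule E))

variable {E}

/-- The function underlying an element of `H(E)`. -/
def Holo.fn (f : Holo E) : E → ℂ := Subtype.val f

theorem Holo.continuous (f : Holo E) : Continuous f.fn := f.2.1

@[ext] theorem Holo.ext {f g : Holo E} (h : ∀ x, f.fn x = g.fn x) : f = g :=
  Subtype.ext (funext h)

@[simp] theorem Holo.fn_add (f g : Holo E) : (f + g).fn = f.fn + g.fn := rfl

@[simp] theorem Holo.fn_zero : (0 : Holo E).fn = 0 := rfl

@[simp] theorem Holo.fn_smul (c : ℂ) (f : Holo E) : (c • f).fn = c • f.fn := rfl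

/-- An element of `H(E)` as a continuous map. -/
def Holo.toCM (f : Holo E) : C(E, ℂ) := ⟨f.fn, f.continuous⟩

/-! ### The three topologies -/

variable (E)

/-- The compact-open topology `τ₀` on `H(E)`. -/
def tauZero : TopologicalSpace (Holo E) :=
  TopologicalSpace.induced Holo.toCM ContinuousMap.compactOpen

/-- The vector space topology generated by a set of seminorms. -/
def topologyOfSeminorms {X : Type*} [AddCommGroup X] [Module ℂ X] (Q : Set (Seminorm ℂ X)) :
    TopologicalSpace X :=
  (SeminormFamily.moduleFilterBasis (fun q : Q => (q : Seminorm ℂ X))).topology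

variable {E}

/-- The seminorm `q` on `H(E)` is ported by the set `K`: for every open `V ⊇ K` there is `C > 0`
with `q f ≤ C * sup_V |f|` for all `f`, where the supremum may be infinite. -/
def IsPortedBy (q : Seminorm ℂ (Holo E)) (K : Set E) : Prop :=
  ∀ V : Set E, IsOpen V → K ⊆ V →
    ∃ C : NNReal, 0 < C ∧ ∀ f : Holo E, ENNReal.ofReal (q f) ≤ C * ⨆ x ∈ V, ‖f.fn x‖ₑ

/-- The seminorm `q` on `H(E)` is `τ_δ`-continuous: for every increasing countable open cover
`(V n)` of `E` there are `n` and `C > 0` with `q f ≤ C * sup_{V n} |f|` for all `f`. -/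
def IsDeltaContinuous (q : Seminorm ℂ (Holo E)) : Prop :=
  ∀ V : ℕ → Set E, (∀ n, IsOpen (V n)) → Monotone V → ⋃ n, V n = univ →
    ∃ n : ℕ, ∃ C : NNReal, 0 < C ∧
      ∀ f : Holo E, ENNReal.ofReal (q f) ≤ C * ⨆ x ∈ V n, ‖f.fn x‖ₑ

variable (E)

/-- The Nachbin compact-ported topology `τ_ω` on `H(E)`. -/
def tauOmega : TopologicalSpace (Holo E) :=
  topologyOfSeminorms {q | ∃ K : Set E, IsCompact K ∧ IsPortedBy q K}

/-- The bornological topology `τ_δ` on `H(E)`. -/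
def tauDelta : TopologicalSpace (Holo E) :=
  topologyOfSeminorms {q | IsDeltaContinuous q}

end Holo

/-! ### Translations, convolution operators, hypercyclicity -/

section Operators

variable {E : Type*} [AddCommGroup E] [Module ℂ E] [TopologicalSpace E] [IsTopologicalAddGroup E]

/-- The translation operator `(τ_a f)(x) = f (x - a)` on `H(E)`. -/
def translation (a : E) : Holo E →ₗ[ℂ] Holo E where
  toFun f := ⟨fun x => f.fn (x - a), f.continuous.comp (continuous_id.sub continuous_const),
    fun b c => by
      have h := f.2.2 (b - a) c
      have e : (fun z : ℂ => f.fn (b + z • c - a)) = fun z : ℂ => f.fn (b - a + z • c) := by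
        funext z; congr 1; abel
      rw [e]; exact h⟩
  map_add' _ _ := rfl
  map_smul' _ _ := rfl

/-- A convolution operator on `(H(E), τ)`: a `τ`-continuous linear operator which commutes with
all translations. -/
def IsConvolutionOperator (τ : TopologicalSpace (Holo E)) (L : Holo E →ₗ[ℂ] Holo E) : Prop :=
  Continuous[τ, τ] L ∧ ∀ (b : E) (f : Holo E), L (translation b f) = translation b (L f)

/-- Some orbit `{x, T x, T² x, …}` of the linear operator `T` is dense for the topology `τ`. -/
def IsHypercyclic {X : Type*} [AddCommGroup X] [Module ℂ X] (τ : TopologicalSpace X)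
    (T : X →ₗ[ℂ] X) : Prop :=
  ∃ x : X, @Dense X τ (Set.range fun n : ℕ => (T ^ n) x)

end Operators

/-! ### Entire functions of bounded type on a normed space -/

section BoundedType

variable {X : Type*} [NormedAddCommGroup X] [NormedSpace ℂ X]

/-- The norm `‖d̂ᵐ f(0)‖`: the supremum over the closed unit ball of the modulus of the
`m`-homogeneous polynomial `d̂ᵐ f(0)`, which is `x ↦ (Dᵐ f)(0)(x, …, x)`. -/
def taylorNorm (f : X → ℂ) (m : ℕ) : ℝ :=
  ⨆ x : Metric.closedBall (0 : X) 1, ‖iteratedFDeriv ℂ m f 0 fun _ => (x : X)‖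

theorem taylorNorm_nonneg (f : X → ℂ) (m : ℕ) : 0 ≤ taylorNorm f m :=
  Real.iSup_nonneg fun _ => norm_nonneg _

theorem taylorNorm_bdd (f : X → ℂ) (m : ℕ) :
    BddAbove (range fun x : Metric.closedBall (0 : X) 1 =>
      ‖iteratedFDeriv ℂ m f 0 fun _ => (x : X)‖) := by
  refine ⟨‖iteratedFDeriv ℂ m f 0‖, ?_⟩
  rintro _ ⟨x, rfl⟩
  have hx : ‖(x : X)‖ ≤ 1 := mem_closedBall_zero_iff.1 x.2
  refine ((iteratedFDeriv ℂ m f 0).le_opNorm _).trans ?_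
  refine mul_le_of_le_one_right (norm_nonneg _) ?_
  exact Finset.prod_le_one (fun _ _ => norm_nonneg _) fun _ _ => hx

theorem le_taylorNorm (f : X → ℂ) (m : ℕ) {x : X} (hx : ‖x‖ ≤ 1) :
    ‖iteratedFDeriv ℂ m f 0 fun _ => x‖ ≤ taylorNorm f m :=
  le_ciSup (taylorNorm_bdd f m) (⟨x, mem_closedBall_zero_iff.2 hx⟩ : Metric.closedBall (0 : X) 1)

theorem taylorNorm_le (f : X → ℂ) (m : ℕ) {M : ℝ}
    (h : ∀ x : X, ‖x‖ ≤ 1 → ‖iteratedFDeriv ℂ m f 0 fun _ => x‖ ≤ M) : taylorNorm f m ≤ M := by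
  have : Nonempty (Metric.closedBall (0 : X) 1) := ⟨⟨0, by simp⟩⟩
  exact ciSup_le fun x => h x (mem_closedBall_zero_iff.1 x.2)

theorem contDiffAt_of_entire {f : X → ℂ} (hf : AnalyticOnNhd ℂ f univ) (m : ℕ) :
    ContDiffAt ℂ m f 0 :=
  (hf 0 (mem_univ _)).contDiffAt

theorem taylorNorm_add_le {f g : X → ℂ} (hf : AnalyticOnNhd ℂ f univ)
    (hg : AnalyticOnNhd ℂ g univ) (m : ℕ) :
    taylorNorm (f + g) m ≤ taylorNorm f m + taylorNorm g m := by
  refine taylorNorm_le _ _ fun x hx => ?_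
  rw [iteratedFDeriv_add_apply (contDiffAt_of_entire hf m) (contDiffAt_of_entire hg m)]
  exact (norm_add_le _ _).trans (add_le_add (le_taylorNorm f m hx) (le_taylorNorm g m hx))

theorem taylorNorm_smul {f : X → ℂ} (hf : AnalyticOnNhd ℂ f univ) (c : ℂ) (m : ℕ) :
    taylorNorm (c • f) m = ‖c‖ * taylorNorm f m := by
  unfold taylorNorm
  rw [iteratedFDeriv_const_smul_apply (contDiffAt_of_entire hf m),
    Real.mul_iSup_of_nonneg (norm_nonneg c)]
  simp

theorem taylorNorm_zero (m : ℕ) : taylorNorm (0 : X → ℂ) m = 0 := by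
  have h := taylorNorm_smul (X := X) (f := 0) (fun _ _ => analyticAt_const) 0 m
  simpa using h

theorem tendsto_root_iff {c : ℕ → ℝ} (hc : ∀ m, 0 ≤ c m) :
    Tendsto (fun m : ℕ => c m ^ (1 / (m : ℝ))) atTop (𝓝 0) ↔
      ∀ ρ : ℝ, 0 < ρ → Summable fun m : ℕ => ρ ^ m * c m := by
  constructor
  · intro h ρ hρ
    have hev : ∀ᶠ m : ℕ in atTop, c m ^ (1 / (m : ℝ)) < 1 / (2 * ρ) :=
      h.eventually_lt_const (by positivity)
    refine Summable.of_norm_bounded_eventually_nat (g := fun m : ℕ => (1 / 2 : ℝ) ^ m)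
      (summable_geometric_of_lt_one (by norm_num) (by norm_num)) ?_
    filter_upwards [hev, eventually_ge_atTop 1] with m hm h1
    have hm0 : m ≠ 0 := by omega
    have h2 : c m ≤ (1 / (2 * ρ)) ^ m := by
      have h3 := pow_le_pow_left₀ (Real.rpow_nonneg (hc m) _) hm.le m
      rwa [one_div (m : ℝ), Real.rpow_inv_natCast_pow (hc m) hm0] at h3
    rw [Real.norm_of_nonneg (mul_nonneg (by positivity) (hc m))]
    calc ρ ^ m * c m ≤ ρ ^ m * (1 / (2 * ρ)) ^ m := by gcongr
      _ = (1 / 2 : ℝ) ^ m := by rw [← mul_pow]; congr 1; field_simp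
  · intro h
    rw [Metric.tendsto_atTop']
    intro ε hε
    have h1 := (h (2 / ε) (by positivity)).tendsto_atTop_zero
    have h2 : ∀ᶠ m : ℕ in atTop, (2 / ε) ^ m * c m < 1 := h1.eventually_lt_const one_pos
    obtain ⟨N, hN⟩ := eventually_atTop.1 h2
    refine ⟨N, fun m hm => ?_⟩
    have hm0 : m ≠ 0 := by omega
    have h3 : c m ≤ (ε / 2) ^ m := by
      have h4 := (hN m hm.le).le
      have h5 : (ε / 2) ^ m * ((2 / ε) ^ m * c m) ≤ (ε / 2) ^ m * 1 := by gcongr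
      rwa [← mul_assoc, ← mul_pow, show ε / 2 * (2 / ε) = 1 by field_simp, one_pow, one_mul,
        mul_one] at h5
    rw [Real.dist_eq, sub_zero, abs_of_nonneg (Real.rpow_nonneg (hc m) _), one_div]
    calc c m ^ ((m : ℝ)⁻¹) ≤ ((ε / 2) ^ m) ^ ((m : ℝ)⁻¹) :=
          Real.rpow_le_rpow (hc m) h3 (by positivity)
      _ = ε / 2 := Real.pow_rpow_inv_natCast (by positivity) hm0
      _ < ε := by linarith

variable (X)

/-- `f : X → ℂ` is an entire function of bounded type: it is given by a power series around every
point, and `‖d̂ᵐ f(0) / m!‖ ^ (1/m) → 0`. -/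
def IsBoundedType (f : X → ℂ) : Prop :=
  AnalyticOnNhd ℂ f univ ∧
    Tendsto (fun m : ℕ => (taylorNorm f m / m.factorial) ^ (1 / (m : ℝ))) atTop (𝓝 0)

variable {X}

theorem isBoundedType_iff {f : X → ℂ} : IsBoundedType X f ↔ AnalyticOnNhd ℂ f univ ∧
    ∀ ρ : ℝ, 0 < ρ → Summable fun m : ℕ => ρ ^ m / m.factorial * taylorNorm f m := by
  unfold IsBoundedType
  rw [tendsto_root_iff fun m => div_nonneg (taylorNorm_nonneg f m) (by positivity)]
  simp only [mul_div_assoc', div_mul_eq_mul_div]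

variable (X)

/-- The space `H_b(X)` of entire functions of bounded type on the normed space `X`. -/
def hbSubmodule : Submodule ℂ (X → ℂ) where
  carrier := {f | IsBoundedType X f}
  add_mem' := by
    intro f g hf hg
    have hf' := isBoundedType_iff.1 hf
    have hg' := isBoundedType_iff.1 hg
    refine isBoundedType_iff.2 ⟨hf.1.add hg.1, fun ρ hρ => ?_⟩
    refine Summable.of_nonneg_of_le
      (fun m => mul_nonneg (by positivity) (taylorNorm_nonneg _ m)) (fun m => ?_)
      ((hf'.2 ρ hρ).add (hg'.2 ρ hρ))
    rw [← mul_add]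
    exact mul_le_mul_of_nonneg_left (taylorNorm_add_le hf.1 hg.1 m) (by positivity)
  zero_mem' := isBoundedType_iff.2
    ⟨fun _ _ => analyticAt_const, fun ρ _ => by simp [taylorNorm_zero]⟩
  smul_mem' := by
    intro c f hf
    refine isBoundedType_iff.2 ⟨fun x hx => analyticAt_const.smul (hf.1 x hx), fun ρ hρ => ?_⟩
    have h := ((isBoundedType_iff.1 hf).2 ρ hρ).mul_left ‖c‖
    refine h.congr fun m => ?_
    rw [taylorNorm_smul hf.1]; ring

/-- `H_b(X)` as a type of its own, so that its only topology is the one defined below. -/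
def Hb : Type _ := hbSubmodule X

instance : AddCommGroup (Hb X) := inferInstanceAs (AddCommGroup (hbSubmodule X))

instance : Module ℂ (Hb X) := inferInstanceAs (Module ℂ (hbSubmodule X))

variable {X}

/-- The function underlying an element of `H_b(X)`. -/
def Hb.fn (f : Hb X) : X → ℂ := Subtype.val f

theorem Hb.isBoundedType (f : Hb X) : IsBoundedType X f.fn := f.2

/-- The seminorm `‖f‖_ρ = ∑ₘ (ρᵐ / m!) ‖d̂ᵐ f(0)‖` on `H_b(X)`, for `ρ > 0`. -/
def hbSeminorm (ρ : {ρ : ℝ // 0 < ρ}) : Seminorm ℂ (Hb X) :=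
  Seminorm.of
    (fun f => ∑' m : ℕ, (ρ : ℝ) ^ m / m.factorial * taylorNorm f.fn m)
    (by
      intro f g
      have hf := (isBoundedType_iff.1 f.isBoundedType).2 ρ ρ.2
      have hg := (isBoundedType_iff.1 g.isBoundedType).2 ρ ρ.2
      have hfg := (isBoundedType_iff.1 (f + g).isBoundedType).2 ρ ρ.2
      rw [← hf.tsum_add hg]
      refine hfg.tsum_le_tsum (fun m => ?_) (hf.add hg)
      rw [← mul_add]
      have := ρ.2
      exact mul_le_mul_of_nonneg_left
        (taylorNorm_add_le f.isBoundedType.1 g.isBoundedType.1 m) (by positivity))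
    (by
      intro c f
      rw [← tsum_mul_left]
      refine tsum_congr fun m => ?_
      have h : taylorNorm (c • f).fn m = ‖c‖ * taylorNorm f.fn m :=
        taylorNorm_smul f.isBoundedType.1 c m
      rw [h]; ring)

variable (X)

/-- The Fréchet topology of `H_b(X)`, generated by the seminorms `‖·‖_ρ`, `ρ > 0`. -/
def hbTopology : TopologicalSpace (Hb X) :=
  (SeminormFamily.moduleFilterBasis
    (fun ρ : {ρ : ℝ // 0 < ρ} => (hbSeminorm ρ : Seminorm ℂ (Hb X)))).topology

end BoundedType

/-! ### Entire functions of uniform bounded type on a locally convex space -/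

section UniformBoundedType

variable {E : Type*} [AddCommGroup E] [Module ℂ E]

/-- A copy of `E`, to be equipped with the seminorm `p`. -/
def SemiSpace (_p : Seminorm ℂ E) : Type _ := E

instance (p : Seminorm ℂ E) : AddCommGroup (SemiSpace p) := inferInstanceAs (AddCommGroup E)

instance (p : Seminorm ℂ E) : Module ℂ (SemiSpace p) := inferInstanceAs (Module ℂ E)

instance (p : Seminorm ℂ E) : SeminormedAddCommGroup (SemiSpace p) :=
  AddGroupSeminorm.toSeminormedAddCommGroup (E := SemiSpace p) p.toAddGroupSeminorm

instance (p : Seminorm ℂ E) : NormedSpace ℂ (SemiSpace p) where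
  norm_smul_le c x := (map_smul_eq_mul p c x).le

/-- The normed space `E_p = (E, p) / p⁻¹(0)`. -/
abbrev NormedQuot (p : Seminorm ℂ E) : Type _ := SeparationQuotient (SemiSpace p)

/-- The canonical surjection `π_p : E → E_p`. -/
def piMap (p : Seminorm ℂ E) : E →ₗ[ℂ] NormedQuot p where
  toFun x := SeparationQuotient.mk (x : SemiSpace p)
  map_add' _ _ := rfl
  map_smul' _ _ := rfl

theorem norm_piMap (p : Seminorm ℂ E) (x : E) : ‖piMap p x‖ = p x := rfl

theorem piMap_surjective (p : Seminorm ℂ E) : Function.Surjective (piMap p) :=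
  SeparationQuotient.surjective_mk (X := SemiSpace p)

/-- For `p ≤ q`, the canonical contraction `E_q → E_p`. -/
theorem exists_connecting {p q : Seminorm ℂ E} (h : p ≤ q) :
    ∃ T : NormedQuot q →L[ℂ] NormedQuot p, (∀ x, T (piMap q x) = piMap p x) ∧ ∀ y, ‖T y‖ ≤ ‖y‖ := by
  have hb : ∀ x : SemiSpace q, ‖piMap p x‖ ≤ 1 * ‖x‖ := fun x => by
    rw [one_mul]; exact h x
  let L : SemiSpace q →ₗ[ℂ] NormedQuot p :=
    { toFun := fun x => piMap p x
      map_add' := fun x y => map_add (piMap p) x y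
      map_smul' := fun c x => map_smul (piMap p) c x }
  let S : SemiSpace q →L[ℂ] NormedQuot p := L.mkContinuous 1 hb
  have hS : ∀ x y, Inseparable x y → S x = S y := fun x y hxy => (hxy.map S.continuous).eq
  refine ⟨SeparationQuotient.liftCLM S hS, fun x => rfl, fun y => ?_⟩
  obtain ⟨x, rfl⟩ := piMap_surjective q y
  exact h x

theorem IsBoundedType.comp_contraction {X Y : Type*} [NormedAddCommGroup X] [NormedSpace ℂ X]
    [NormedAddCommGroup Y] [NormedSpace ℂ Y] {g : X → ℂ} (hg : IsBoundedType X g) (T : Y →L[ℂ] X)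
    (hT : ∀ y, ‖T y‖ ≤ ‖y‖) : IsBoundedType Y (g ∘ T) := by
  have hA : AnalyticOnNhd ℂ (g ∘ T) univ := fun y _ =>
    (hg.1 (T y) (mem_univ _)).comp (T.analyticAt y)
  refine isBoundedType_iff.2 ⟨hA, fun ρ hρ => ?_⟩
  refine Summable.of_nonneg_of_le
    (fun m => mul_nonneg (by positivity) (taylorNorm_nonneg _ m)) (fun m => ?_)
    ((isBoundedType_iff.1 hg).2 ρ hρ)
  refine mul_le_mul_of_nonneg_left ?_ (by positivity)
  refine taylorNorm_le _ _ fun y hy => ?_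
  have hc : ContDiff ℂ m g := contDiff_iff_contDiffAt.2 fun x => (hg.1 x (mem_univ _)).contDiffAt
  rw [T.iteratedFDeriv_comp_right hc 0 le_rfl, map_zero]
  exact le_taylorNorm g m ((hT y).trans hy)

variable [TopologicalSpace E] [IsTopologicalAddGroup E]

theorem continuous_piMap {p : Seminorm ℂ E} (hp : Continuous p) : Continuous (piMap p) := by
  refine continuous_iff_continuousAt.2 fun x => ?_
  rw [ContinuousAt, tendsto_iff_norm_sub_tendsto_zero]
  have h : Continuous fun y : E => p (y - x) := hp.comp (continuous_id.sub continuous_const)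
  have h' := h.tendsto x
  simp only [sub_self, map_zero] at h'
  refine h'.congr fun y => ?_
  rw [← map_sub, norm_piMap]

theorem comp_piMap_mem {p : Seminorm ℂ E} (hp : Continuous p) {g : NormedQuot p → ℂ}
    (hg : IsBoundedType _ g) : (fun x => g (piMap p x)) ∈ holoSubmodule E := by
  have hd : Differentiable ℂ g := fun y => (hg.1 y (mem_univ _)).differentiableAt
  refine ⟨hd.continuous.comp (continuous_piMap hp), fun a b => ?_⟩
  simp only [map_add, map_smul]
  exact hd.comp ((differentiable_const _).add (differentiable_id.smul_const _))

variable (E)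

/-- The subspace `H_ub(E)` of `H(E)`: the functions of the form `g ∘ π_p`, where `p` is a
continuous seminorm on `E` and `g` is an entire function of bounded type on `E_p`. -/
def hubSubmodule : Submodule ℂ (Holo E) where
  carrier := {f | ∃ p : Seminorm ℂ E, Continuous p ∧
    ∃ g : Hb (NormedQuot p), ∀ x, f.fn x = g.fn (piMap p x)}
  add_mem' := by
    rintro f₁ f₂ ⟨p₁, hp₁, g₁, h₁⟩ ⟨p₂, hp₂, g₂, h₂⟩
    have hp : Continuous (p₁ ⊔ p₂ : Seminorm ℂ E) := by
      rw [Seminorm.coe_sup]; exact hp₁.sup hp₂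
    obtain ⟨T₁, hT₁, hT₁'⟩ := exists_connecting (le_sup_left : p₁ ≤ p₁ ⊔ p₂)
    obtain ⟨T₂, hT₂, hT₂'⟩ := exists_connecting (le_sup_right : p₂ ≤ p₁ ⊔ p₂)
    refine ⟨p₁ ⊔ p₂, hp, ⟨g₁.fn ∘ T₁ + g₂.fn ∘ T₂, (hbSubmodule _).add_mem
      (g₁.isBoundedType.comp_contraction T₁ hT₁')
      (g₂.isBoundedType.comp_contraction T₂ hT₂')⟩, fun x => ?_⟩
    simp [Hb.fn, h₁, h₂, hT₁, hT₂]
  zero_mem' := ⟨0, continuous_const, 0, fun _ => rfl⟩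
  smul_mem' := by
    rintro c f ⟨p, hp, g, h⟩
    exact ⟨p, hp, c • g, fun x => congrArg (c • ·) (h x)⟩

variable {E}

/-- The map `π_p^* : H_b(E_p) → H_ub(E)`, `g ↦ g ∘ π_p`, for a continuous seminorm `p`. -/
def piStar (p : {p : Seminorm ℂ E // Continuous p}) :
    Hb (NormedQuot p.1) →ₗ[ℂ] hubSubmodule E where
  toFun g := ⟨⟨fun x => g.fn (piMap p.1 x), comp_piMap_mem p.2 g.isBoundedType⟩,
    p.1, p.2, g, fun _ => rfl⟩
  map_add' _ _ := rfl
  map_smul' _ _ := rfl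

variable (E)

/-- The locally convex inductive topology of `H_ub(E)` with respect to the maps `π_p^*`: the finest
locally convex vector space topology for which all of them are continuous. (In Mathlib's order on
topologies the finest one is the least.) -/
def hubTopology : TopologicalSpace (hubSubmodule E) :=
  sInf {t | @IsTopologicalAddGroup _ t _ ∧ @ContinuousSMul ℂ _ _ _ t ∧
    @LocallyConvexSpace ℝ _ _ _ _ _ t ∧
    ∀ p : {p : Seminorm ℂ E // Continuous p}, Continuous[hbTopology _, t] (piStar p)}

end UniformBoundedType

end HolC

end

noncomputable section

namespace HolC

/-! ### Continuous Gâteaux holomorphic functions on finite-dimensional spaces are analytic -/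

section Osgood

/-! Everything rests on one fact: a holomorphic `f` on `ℂ^ℕ` is bounded on some cylinder `|x i| <
ε`, `i < n`. Liouville makes it constant there in the directions whose first `n` coordinates vanish,
and the identity theorem spreads this to the whole space (`dependsOnFirst_of_bounded`). So `f`
depends on finitely many coordinates, and their number is read off the cylinder alone.

Hence all functions bounded on a late member of an increasing open cover share one `k`, and a
seminorm is `τ_δ`-continuous once, for each `k`, it is bounded by a compact supremum on functions of
`k` variables (`isDeltaContinuous_of_dependsOnFirst`). A suitable sum of differences is then `τ_δ`-
but not `τ₀`-continuous. The same criterion identifies `τ_δ` with the inductive topology: functions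
of `k` variables live on a finite-dimensional `E_p`, where Osgood's lemma and Cauchy's estimates put
every holomorphic function in `H_b` and bound its seminorms by suprema over balls.

For `τ₀ = τ_ω`, telescope `f` over the truncations to the first `n` coordinates. The Schwarz lemma
makes the `n`-th increment small if `f` is controlled on a large disc in coordinate `n`, so a big
enough polydisc absorbs all the porting constants (`IsPortedBy.exists_supControlled`).

No translation is hypercyclic, since an orbit never leaves the functions of the first `n`
coordinates. -/

theorem differentiable_dslope_zero {g : ℂ → ℂ} (hg : Differentiable ℂ g) :
    Differentiable ℂ (dslope g 0) := by
  rw [← differentiableOn_univ] at hg ⊢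
  exact (Complex.differentiableOn_dslope univ_mem).2 hg

/-- Maximum principle: on the unit circle the slope has modulus `‖g w - g 0‖ ≤ 2 * M`. -/
theorem norm_dslope_zero_le {g : ℂ → ℂ} (hg : Differentiable ℂ g) {M : ℝ}
    (hM : ∀ z : ℂ, ‖z‖ ≤ 1 → ‖g z‖ ≤ M) {z : ℂ} (hz : ‖z‖ ≤ 1) : ‖dslope g 0 z‖ ≤ 2 * M := by
  refine Complex.norm_le_of_forall_mem_frontier_norm_le (U := Metric.ball (0 : ℂ) 1)
    Metric.isBounded_ball (differentiable_dslope_zero hg).diffContOnCl (fun w hw => ?_) ?_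
  · rw [frontier_ball _ one_ne_zero, mem_sphere_zero_iff_norm] at hw
    have hw0 : w ≠ 0 := by rintro rfl; simp at hw
    rw [dslope_of_ne _ hw0, slope_def_field, norm_div, sub_zero, hw, div_one]
    have h0 := hM 0 (by simp)
    have h1 := hM w hw.le
    linarith [norm_sub_le (g w) (g 0)]
  · rw [closure_ball _ one_ne_zero]
    simpa using hz

/-- The remainder is `t ^ 2` times the twice iterated `dslope`; each iteration doubles the bound. -/
theorem norm_sub_linear_le {g : ℂ → ℂ} (hg : Differentiable ℂ g) {M : ℝ}
    (hM : ∀ z : ℂ, ‖z‖ ≤ 1 → ‖g z‖ ≤ M) {t : ℂ} (ht : ‖t‖ ≤ 1) :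
    ‖g t - g 0 - t * deriv g 0‖ ≤ 4 * M * ‖t‖ ^ 2 := by
  have hd := differentiable_dslope_zero hg
  have h1 := norm_dslope_zero_le hd (fun z hz => norm_dslope_zero_le hg hM hz) ht
  have e1 : t * dslope g 0 t = g t - g 0 := by simpa using sub_smul_dslope g 0 t
  have e2 : t * dslope (dslope g 0) 0 t = dslope g 0 t - deriv g 0 := by
    simpa using sub_smul_dslope (dslope g 0) 0 t
  have e3 : g t - g 0 - t * deriv g 0 = t ^ 2 * dslope (dslope g 0) 0 t := by
    rw [pow_two, mul_assoc, e2, mul_sub, e1]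
  rw [e3, norm_mul, norm_pow]
  nlinarith [sq_nonneg ‖t‖]

/-! ### Line derivatives and smoothness in finite dimension -/

section LineDerivative

variable {E : Type*} [NormedAddCommGroup E] [NormedSpace ℂ E] {f : E → ℂ}

theorem lineDeriv_eq_deriv_comp (f : E → ℂ) (x v : E) :
    lineDeriv ℂ f x v = deriv (fun z : ℂ => f (x + z • v)) 0 := rfl

theorem norm_sub_lineDeriv_le (hf : f ∈ holoSubmodule E) {x v : E} {M : ℝ}
    (hM : ∀ z : ℂ, ‖z‖ ≤ 1 → ‖f (x + z • v)‖ ≤ M) {t : ℂ} (ht : ‖t‖ ≤ 1) :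
    ‖f (x + t • v) - f x - t * lineDeriv ℂ f x v‖ ≤ 4 * M * ‖t‖ ^ 2 := by
  have := norm_sub_linear_le (hf.2 x v) hM ht
  simpa [lineDeriv_eq_deriv_comp] using this

variable [FiniteDimensional ℂ E]

theorem exists_bound_closedBall (hf : Continuous f) (R : ℝ) :
    ∃ M : ℝ, 0 ≤ M ∧ ∀ x : E, ‖x‖ ≤ R → ‖f x‖ ≤ M := by
  have := FiniteDimensional.proper ℂ E
  obtain ⟨M, hM⟩ := (isCompact_closedBall (0 : E) R).exists_bound_of_continuousOn hf.continuousOn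
  exact ⟨max M 0, le_max_right _ _, fun x hx => (hM x (by simpa using hx)).trans (le_max_left _ _)⟩

/-- Compactness of balls makes the quadratic remainder uniform in base point and direction; this
single estimate yields the holomorphy and additivity of the line derivative and Fréchet
differentiability. -/
theorem exists_bound_lineDeriv (hf : f ∈ holoSubmodule E) (R r : ℝ) :
    ∃ M : ℝ, 0 ≤ M ∧ ∀ x v : E, ‖x‖ ≤ R → ‖v‖ ≤ r → ∀ t : ℂ, ‖t‖ ≤ 1 →
      ‖f (x + t • v) - f x - t * lineDeriv ℂ f x v‖ ≤ M * ‖t‖ ^ 2 := by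
  obtain ⟨M, hM0, hM⟩ := exists_bound_closedBall hf.1 (R + r)
  refine ⟨4 * M, by positivity, fun x v hx hv t ht => norm_sub_lineDeriv_le hf (fun z hz => ?_) ht⟩
  refine hM _ ((norm_add_le _ _).trans (add_le_add hx ?_))
  rw [norm_smul]
  nlinarith [norm_nonneg z, norm_nonneg v]

/-- The difference quotients in direction `v` converge locally uniformly to the line derivative. -/
theorem tendstoLocallyUniformly_lineDeriv (hf : f ∈ holoSubmodule E) (v : E) :
    TendstoLocallyUniformly (fun (n : ℕ) (x : E) =>
      ((n : ℂ) + 1) * (f (x + ((n : ℂ) + 1)⁻¹ • v) - f x)) (fun x => lineDeriv ℂ f x v) atTop := by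
  rw [Metric.tendstoLocallyUniformly_iff]
  intro ε hε x
  obtain ⟨M, hM0, hM⟩ := exists_bound_lineDeriv hf (‖x‖ + 1) ‖v‖
  refine ⟨Metric.ball x 1, Metric.ball_mem_nhds x one_pos, ?_⟩
  have hlim : Tendsto (fun n : ℕ => M * (1 / ((n : ℝ) + 1))) atTop (𝓝 0) := by
    simpa using tendsto_one_div_add_atTop_nhds_zero_nat.const_mul M
  filter_upwards [hlim.eventually_lt_const hε] with n hn y hy
  have hy' : ‖y‖ ≤ ‖x‖ + 1 := by
    have := norm_le_norm_add_norm_sub' y x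
    rw [mem_ball_iff_norm] at hy
    linarith
  have hn0 : ((n : ℂ) + 1) ≠ 0 := by exact_mod_cast Nat.succ_ne_zero n
  have hnn : ‖((n : ℂ) + 1)‖ = (n : ℝ) + 1 := by
    have h : ((n : ℂ) + 1) = ((n + 1 : ℕ) : ℂ) := by push_cast; rfl
    rw [h, Complex.norm_natCast]; push_cast; rfl
  have hpos : (0 : ℝ) < (n : ℝ) + 1 := by positivity
  have h := hM y v hy' le_rfl ((n : ℂ) + 1)⁻¹ (by
    rw [norm_inv, hnn]; exact inv_le_one_of_one_le₀ (by linarith [(n.cast_nonneg : (0 : ℝ) ≤ n)]))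
  have e : ((n : ℂ) + 1) * (f (y + ((n : ℂ) + 1)⁻¹ • v) - f y) - lineDeriv ℂ f y v =
      ((n : ℂ) + 1) * (f (y + ((n : ℂ) + 1)⁻¹ • v) - f y - ((n : ℂ) + 1)⁻¹ * lineDeriv ℂ f y v) := by
    field_simp
  rw [dist_comm, dist_eq_norm, e, norm_mul, hnn]
  rw [norm_inv, hnn] at h
  calc _ ≤ ((n : ℝ) + 1) * (M * ((n : ℝ) + 1)⁻¹ ^ 2) := by gcongr
    _ = M * (1 / ((n : ℝ) + 1)) := by field_simp
    _ < ε := hn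

theorem lineDeriv_mem_holoSubmodule (hf : f ∈ holoSubmodule E) (v : E) :
    (fun x => lineDeriv ℂ f x v) ∈ holoSubmodule E := by
  have h := tendstoLocallyUniformly_lineDeriv hf v
  refine ⟨h.continuous (Frequently.of_forall fun n => ?_), fun a b => ?_⟩
  · exact continuous_const.mul ((hf.1.comp (continuous_id.add continuous_const)).sub hf.1)
  · have hc : Continuous fun z : ℂ => a + z • b := by fun_prop
    have h2 := (tendstoLocallyUniformlyOn_univ.2 (h.comp _ hc)).differentiableOn
      (Eventually.of_forall fun n => ?_) isOpen_univ
    · exact differentiableOn_univ.1 h2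
    · refine Differentiable.differentiableOn ?_
      have h3 := hf.2 (a + ((n : ℂ) + 1)⁻¹ • v) b
      simp only [add_right_comm a] at h3
      exact (h3.sub (hf.2 a b)).const_mul _

theorem tendsto_zero_of_norm_le_mul {c : ℂ → ℂ} {l : ℂ} {M : ℝ}
    (hc : Tendsto c (𝓝[≠] 0) (𝓝 l)) (h : ∀ t : ℂ, ‖t‖ ≤ 1 → t ≠ 0 → ‖c t‖ ≤ M * ‖t‖) : l = 0 := by
  refine tendsto_nhds_unique hc ?_
  have hM : Tendsto (fun t : ℂ => M * ‖t‖) (𝓝[≠] 0) (𝓝 0) := by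
    have : Continuous fun t : ℂ => M * ‖t‖ := by fun_prop
    simpa using (this.tendsto 0).mono_left nhdsWithin_le_nhds
  refine squeeze_zero_norm' ?_ hM
  filter_upwards [self_mem_nhdsWithin, nhdsWithin_le_nhds (Metric.closedBall_mem_nhds (0 : ℂ) one_pos)]
    with t ht ht'
  exact h t (by simpa using ht') ht

/-- Reach `x + t • (h + k)` directly and via `x + t • h`, and compare first-order terms; continuity
of the line derivative in the base point removes the shift by `t • h`. -/
theorem lineDeriv_add_of_mem_holoSubmodule (hf : f ∈ holoSubmodule E) (x h k : E) :
    lineDeriv ℂ f x (h + k) = lineDeriv ℂ f x h + lineDeriv ℂ f x k := by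
  obtain ⟨M, hM0, hM⟩ := exists_bound_lineDeriv hf (‖x‖ + ‖h‖) (‖h‖ + ‖k‖)
  have hcont : Continuous fun t : ℂ =>
      lineDeriv ℂ f x (h + k) - lineDeriv ℂ f x h - lineDeriv ℂ f (x + t • h) k := by
    have := (lineDeriv_mem_holoSubmodule hf k).1
    exact continuous_const.sub (this.comp (by fun_prop : Continuous fun t : ℂ => x + t • h))
  -- One `M` for each of the three quadratic remainders.
  have hl := tendsto_zero_of_norm_le_mul (M := 3 * M)
    ((hcont.tendsto 0).mono_left nhdsWithin_le_nhds) (fun t ht ht0 => ?_)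
  · rw [zero_smul, add_zero, sub_sub, sub_eq_zero] at hl
    exact hl
  · have h1 := hM x (h + k) (by linarith [norm_nonneg h]) (norm_add_le _ _) t ht
    have h2 := hM x h (by linarith [norm_nonneg h]) (by linarith [norm_nonneg k]) t ht
    have hth : ‖t • h‖ ≤ ‖h‖ := by
      rw [norm_smul]; exact mul_le_of_le_one_left (norm_nonneg _) ht
    have h3 := hM (x + t • h) k ((norm_add_le _ _).trans (by linarith))
      (by linarith [norm_nonneg h]) t ht
    rw [add_assoc, ← smul_add] at h3
    have e : t * (lineDeriv ℂ f x (h + k) - lineDeriv ℂ f x h - lineDeriv ℂ f (x + t • h) k) =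
      (f (x + t • (h + k)) - f (x + t • h) - t * lineDeriv ℂ f (x + t • h) k)
      + (f (x + t • h) - f x - t * lineDeriv ℂ f x h)
      - (f (x + t • (h + k)) - f x - t * lineDeriv ℂ f x (h + k)) := by ring
    have ht' : 0 < ‖t‖ := norm_pos_iff.2 ht0
    have h4 : ‖t‖ * ‖lineDeriv ℂ f x (h + k) - lineDeriv ℂ f x h - lineDeriv ℂ f (x + t • h) k‖ ≤
        ‖t‖ * (3 * M * ‖t‖) := by
      rw [← norm_mul, e]
      refine (norm_sub_le _ _).trans ((add_le_add (norm_add_le _ _) le_rfl).trans ?_)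
      nlinarith
    exact le_of_mul_le_mul_left h4 ht'

theorem hasFDerivAt_of_mem_holoSubmodule (hf : f ∈ holoSubmodule E) (x : E) :
    ∃ L : E →L[ℂ] ℂ, HasFDerivAt f L x ∧ ∀ v, L v = lineDeriv ℂ f x v := by
  let L : E →ₗ[ℂ] ℂ :=
    { toFun := fun v => lineDeriv ℂ f x v
      map_add' := lineDeriv_add_of_mem_holoSubmodule hf x
      map_smul' := fun c v => lineDeriv_smul }
  refine ⟨LinearMap.toContinuousLinearMap L, ?_, fun v => rfl⟩
  obtain ⟨M, hM0, hM⟩ := exists_bound_lineDeriv hf ‖x‖ 1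
  rw [hasFDerivAt_iff_isLittleO_nhds_zero]
  have hO : (fun h : E => f (x + h) - f x - (LinearMap.toContinuousLinearMap L) h) =O[𝓝 0]
      fun h => ‖h‖ ^ 2 := by
    refine Asymptotics.IsBigO.of_bound M ?_
    filter_upwards [Metric.closedBall_mem_nhds (0 : E) one_pos] with h hh
    rcases eq_or_ne h 0 with rfl | h0
    · simp
    have hn : (‖h‖ : ℂ) ≠ 0 := by exact_mod_cast norm_ne_zero_iff.2 h0
    have := hM x ((‖h‖ : ℂ)⁻¹ • h) le_rfl (by
      rw [norm_smul, norm_inv, Complex.norm_real, norm_norm, inv_mul_cancel₀ (norm_ne_zero_iff.2 h0)])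
      (‖h‖ : ℂ) (by simpa using hh)
    rw [smul_smul, mul_inv_cancel₀ hn, one_smul, lineDeriv_smul, smul_eq_mul, ← mul_assoc,
      mul_inv_cancel₀ hn, one_mul, Complex.norm_real, norm_norm] at this
    rwa [Real.norm_of_nonneg (by positivity)]
  refine hO.trans_isLittleO ?_
  exact Asymptotics.isLittleO_norm_pow_id one_lt_two

/-- The class is stable under directional derivatives, so differentiability bootstraps to every
order. -/
theorem contDiff_of_mem_holoSubmodule (n : ℕ) : ∀ {f : E → ℂ}, f ∈ holoSubmodule E →
    ContDiff ℂ n f := by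
  induction n with
  | zero => exact fun hf => contDiff_zero.2 hf.1
  | succ n ih =>
    intro f hf
    rw [Nat.cast_succ, contDiff_succ_iff_fderiv_apply]
    refine ⟨fun x => ?_, fun h => ?_, fun v => ?_⟩
    · obtain ⟨L, hL, -⟩ := hasFDerivAt_of_mem_holoSubmodule hf x
      exact hL.differentiableAt
    · simp at h
    · have : (fun x => fderiv ℂ f x v) = fun x => lineDeriv ℂ f x v := by
        funext x
        obtain ⟨L, hL, hL'⟩ := hasFDerivAt_of_mem_holoSubmodule hf x
        rw [hL.fderiv, hL']
      rw [this]
      exact ih (lineDeriv_mem_holoSubmodule hf v)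

end LineDerivative

/-! ### Cauchy estimates and Taylor series -/

section Cauchy

variable {E : Type*} [NormedAddCommGroup E] [NormedSpace ℂ E]

/-- Cauchy's estimate for the Fréchet derivative. -/
theorem norm_fderiv_le_of_forall_mem_closedBall {F : Type*} [NormedAddCommGroup F]
    [NormedSpace ℂ F] {g : E → F} (hg : Differentiable ℂ g) {x : E} {M δ : ℝ} (hδ : 0 < δ)
    (hM : ∀ y ∈ Metric.closedBall x δ, ‖g y‖ ≤ M) : ‖fderiv ℂ g x‖ ≤ M / δ := by
  have hM0 : 0 ≤ M := (norm_nonneg _).trans (hM x (Metric.mem_closedBall_self hδ.le))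
  refine ContinuousLinearMap.opNorm_le_bound _ (by positivity) fun v => ?_
  rcases eq_or_ne v 0 with rfl | hv
  · simp
  have hv' : 0 < ‖v‖ := norm_pos_iff.2 hv
  have hline : HasDerivAt (fun z : ℂ => g (x + z • v)) (fderiv ℂ g x v) 0 := by
    have h1 : HasFDerivAt g (fderiv ℂ g x) (x + (0 : ℂ) • v) := by
      simpa using (hg x).hasFDerivAt
    have h2 : HasDerivAt (fun z : ℂ => x + z • v) v 0 := by
      simpa using ((hasDerivAt_id (0 : ℂ)).smul_const v).const_add x
    exact h1.comp_hasDerivAt (0 : ℂ) h2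
  have hd : Differentiable ℂ fun z : ℂ => g (x + z • v) :=
    hg.comp ((differentiable_const _).add (differentiable_id.smul_const _))
  have := Complex.norm_deriv_le_of_forall_mem_sphere_norm_le (c := 0) (R := δ / ‖v‖) (C := M)
    (by positivity) hd.diffContOnCl (fun z hz => hM _ ?_)
  · rw [hline.deriv] at this
    refine this.trans (le_of_eq ?_)
    field_simp
  · rw [mem_sphere_zero_iff_norm] at hz
    rw [mem_closedBall_iff_norm, add_sub_cancel_left, norm_smul, hz]
    field_simp
    exact le_rfl

/-- Apply the first-order estimate `m` times, giving up radius `δ` each time. -/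
theorem norm_iteratedFDeriv_le_of_forall_mem_closedBall {f : E → ℂ} (hf : ∀ n : ℕ, ContDiff ℂ n f)
    {M δ : ℝ} (hδ : 0 < δ) (m : ℕ) : ∀ {x : E}, (∀ y ∈ Metric.closedBall x (m * δ), ‖f y‖ ≤ M) →
      ‖iteratedFDeriv ℂ m f x‖ ≤ M / δ ^ m := by
  induction m with
  | zero =>
    intro x h
    simpa using h x (by simp)
  | succ m ih =>
    intro x h
    rw [← norm_fderiv_iteratedFDeriv, pow_succ, ← div_div]
    have hd : Differentiable ℂ (iteratedFDeriv ℂ m f) :=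
      (hf (m + 1)).differentiable_iteratedFDeriv (by exact_mod_cast Nat.lt_succ_self m)
    refine norm_fderiv_le_of_forall_mem_closedBall hd hδ fun y hy => ih fun w hw => h w ?_
    rw [Metric.mem_closedBall] at hy hw ⊢
    push_cast
    linarith [dist_triangle w y x]

theorem iteratedDeriv_comp_line {f : E → ℂ} (hf : ∀ n : ℕ, ContDiff ℂ n f) (x v : E) (m : ℕ) :
    iteratedDeriv m (fun z : ℂ => f (x + z • v)) 0 = iteratedFDeriv ℂ m f x fun _ => v := by
  have hs : ContDiff ℂ m fun y => f (x + y) := (hf m).comp (contDiff_const.add contDiff_id)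
  have h := (ContinuousLinearMap.toSpanSingleton ℂ v).iteratedFDeriv_comp_right hs 0 le_rfl
  rw [map_zero, iteratedFDeriv_comp_add_left, add_zero] at h
  have e : (fun z : ℂ => f (x + z • v)) =
      (fun y => f (x + y)) ∘ ContinuousLinearMap.toSpanSingleton ℂ v := by
    funext z; simp
  rw [iteratedDeriv_eq_iteratedFDeriv, e, h]
  simp

/-- The Taylor expansion of an entire function converges everywhere. -/
theorem hasSum_taylor {f : E → ℂ} (hf : ∀ n : ℕ, ContDiff ℂ n f) (x v : E) :
    HasSum (fun m : ℕ => (m.factorial : ℂ)⁻¹ * iteratedFDeriv ℂ m f x fun _ => v) (f (x + v)) := by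
  have hd : Differentiable ℂ fun z : ℂ => f (x + z • v) :=
    ((hf 1).differentiable one_ne_zero).comp
      ((differentiable_const _).add (differentiable_id.smul_const _))
  have h := Complex.hasSum_taylorSeries_of_entire hd 0 1
  simpa [iteratedDeriv_comp_line hf] using h

/-- On the diagonal the one-variable Cauchy estimate applies, avoiding the `m ^ m` loss of the
multilinear norm. -/
theorem norm_iteratedFDeriv_line_le {f : E → ℂ} (hf : ∀ n : ℕ, ContDiff ℂ n f) {R M : ℝ}
    (hR : 0 < R) (hM : ∀ y : E, ‖y‖ ≤ R → ‖f y‖ ≤ M) (m : ℕ) {x : E} (hx : ‖x‖ ≤ 1) :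
    ‖iteratedFDeriv ℂ m f 0 fun _ => x‖ ≤ m.factorial * M / R ^ m := by
  have hd : Differentiable ℂ fun z : ℂ => f (0 + z • x) :=
    ((hf 1).differentiable one_ne_zero).comp
      ((differentiable_const _).add (differentiable_id.smul_const _))
  rw [← iteratedDeriv_comp_line hf]
  refine Complex.norm_iteratedDeriv_le_of_forall_mem_sphere_norm_le m hR hd.diffContOnCl
    fun z hz => hM _ ?_
  rw [mem_sphere_zero_iff_norm] at hz
  rw [zero_add, norm_smul, hz]
  exact mul_le_of_le_one_right hR.le hx

theorem analyticAt_of_contDiff_of_bound {f : E → ℂ} (hf : ∀ n : ℕ, ContDiff ℂ n f) {x : E}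
    {M : ℝ} (hM : ∀ y ∈ Metric.closedBall x 1, ‖f y‖ ≤ M) : AnalyticAt ℂ f x := by
  have hM0 : 0 ≤ M := (norm_nonneg _).trans (hM x (by simp))
  let p : FormalMultilinearSeries ℂ E ℂ := fun m => (m.factorial : ℂ)⁻¹ • iteratedFDeriv ℂ m f x
  -- With `δ = 1 / m` the Cauchy bound is `M * m ^ m`, and `m ^ m / m! ≤ e ^ m`, so the radius of
  -- convergence is at least `1 / e`.
  let r : NNReal := ⟨Real.exp (-1), (Real.exp_pos _).le⟩
  have hr : (r : ENNReal) ≤ p.radius := by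
    refine p.le_radius_of_bound M fun m => ?_
    have hp : ‖p m‖ = (m.factorial : ℝ)⁻¹ * ‖iteratedFDeriv ℂ m f x‖ := by
      simp [p, norm_smul]
    have hfac : (0 : ℝ) < m.factorial := by exact_mod_cast m.factorial_pos
    have hb : ‖iteratedFDeriv ℂ m f x‖ ≤ M * (m : ℝ) ^ m := by
      rcases Nat.eq_zero_or_pos m with rfl | hm
      · simpa using hM x (by simp)
      · have hm' : (0 : ℝ) < m := by exact_mod_cast hm
        have := norm_iteratedFDeriv_le_of_forall_mem_closedBall hf (δ := 1 / (m : ℝ)) (M := M)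
          (by positivity) m (x := x) (by rwa [mul_one_div_cancel hm'.ne'])
        simpa [div_eq_mul_inv] using this
    have he := Real.pow_div_factorial_le_exp (m : ℝ) m.cast_nonneg m
    rw [hp]
    change _ * Real.exp (-1) ^ m ≤ M
    rw [← Real.exp_nat_mul, mul_neg_one, Real.exp_neg]
    calc (m.factorial : ℝ)⁻¹ * ‖iteratedFDeriv ℂ m f x‖ * (Real.exp m)⁻¹
        ≤ (m.factorial : ℝ)⁻¹ * (M * (m : ℝ) ^ m) * (Real.exp m)⁻¹ := by gcongr
      _ = M * ((m : ℝ) ^ m / m.factorial) * (Real.exp m)⁻¹ := by ring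
      _ ≤ M * Real.exp m * (Real.exp m)⁻¹ := by gcongr
      _ = M := by rw [mul_assoc, mul_inv_cancel₀ (Real.exp_pos _).ne', mul_one]
  have hps : HasFPowerSeriesOnBall f p x _ :=
    ⟨hr, by
      rw [ENNReal.coe_pos, ← NNReal.coe_pos]
      exact Real.exp_pos _, fun {y} _ => by
      simpa [p] using hasSum_taylor hf x y⟩
  exact hps.analyticAt

end Cauchy

/-- **Osgood's lemma.** -/
theorem analyticOnNhd_of_mem_holoSubmodule {E : Type*} [NormedAddCommGroup E] [NormedSpace ℂ E]
    [FiniteDimensional ℂ E] {f : E → ℂ} (hf : f ∈ holoSubmodule E) : AnalyticOnNhd ℂ f univ := by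
  intro x _
  obtain ⟨M, -, hM⟩ := exists_bound_closedBall hf.1 (‖x‖ + 1)
  refine analyticAt_of_contDiff_of_bound (fun n => contDiff_of_mem_holoSubmodule n hf) (M := M)
    fun y hy => hM y ?_
  rw [mem_closedBall_iff_norm] at hy
  linarith [norm_le_norm_add_norm_sub' y x]

end Osgood

/-! ### Generalities on the three topologies -/

section Generalities

variable {X : Type*} [AddCommGroup X] [Module ℂ X]

theorem withSeminorms_topologyOfSeminorms (Q : Set (Seminorm ℂ X)) :
    @WithSeminorms ℂ X Q _ _ _ (fun q : Q => (q : Seminorm ℂ X)) (topologyOfSeminorms Q) :=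
  @WithSeminorms.mk ℂ X Q _ _ _ _ (topologyOfSeminorms Q) rfl

theorem continuous_topologyOfSeminorms_of_mem {Q : Set (Seminorm ℂ X)} {q : Seminorm ℂ X}
    (hq : q ∈ Q) : @Continuous X ℝ (topologyOfSeminorms Q) _ q :=
  let := topologyOfSeminorms Q
  (withSeminorms_topologyOfSeminorms Q).continuous_seminorm ⟨q, hq⟩

theorem continuous_iff_topologyOfSeminorms {Y : Type*} [TopologicalSpace Y]
    {Q : Set (Seminorm ℂ X)} {u : Y → X} :
    @Continuous Y X _ (topologyOfSeminorms Q) u ↔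
      ∀ y, ∀ q ∈ Q, ∀ ε : ℝ, 0 < ε → ∀ᶠ z in 𝓝 y, q (u z - u y) < ε := by
  let := topologyOfSeminorms Q
  rw [continuous_iff_continuousAt]
  refine forall_congr' fun y => ?_
  rw [ContinuousAt, (withSeminorms_topologyOfSeminorms Q).tendsto_nhds, Subtype.forall]

theorem continuous_linearMap_of_comp_mem {Q Q' : Set (Seminorm ℂ X)} (L : X →ₗ[ℂ] X)
    (h : ∀ q ∈ Q', q.comp L ∈ Q) : Continuous[topologyOfSeminorms Q, topologyOfSeminorms Q'] L := by
  let := topologyOfSeminorms Q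
  rw [continuous_iff_topologyOfSeminorms]
  intro y q hq ε hε
  have hc : Continuous fun z => q.comp L (z - y) := by
    have := (withSeminorms_topologyOfSeminorms Q).topologicalAddGroup
    exact (continuous_topologyOfSeminorms_of_mem (h q hq)).comp
      (continuous_id.sub continuous_const)
  have := (hc.tendsto y).eventually_lt_const (by simpa using hε)
  simpa only [Seminorm.comp_apply, map_sub] using this

theorem topologyOfSeminorms_mono {Q Q' : Set (Seminorm ℂ X)} (h : Q' ⊆ Q) :
    topologyOfSeminorms Q ≤ topologyOfSeminorms Q' :=
  continuous_id_iff_le.1 (continuous_linearMap_of_comp_mem LinearMap.id fun _ hq => h hq)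

variable {E : Type*} [AddCommGroup E] [Module ℂ E] [TopologicalSpace E]

/-- The seminorm `q` on `H(E)` is dominated by a multiple of the supremum over `V`. -/
def SupControlled (q : Seminorm ℂ (Holo E)) (V : Set E) : Prop :=
  ∃ C : ℝ, 0 < C ∧ ∀ (f : Holo E) (B : ℝ), 0 ≤ B → (∀ x ∈ V, ‖f.fn x‖ ≤ B) → q f ≤ C * B

/-- Trades the extended supremum for real bounds `B`; an infinite supremum imposes nothing because
`C > 0`. -/
theorem supControlled_iff {q : Seminorm ℂ (Holo E)} {V : Set E} :
    SupControlled q V ↔ ∃ C : NNReal, 0 < C ∧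
      ∀ f : Holo E, ENNReal.ofReal (q f) ≤ C * ⨆ x ∈ V, ‖f.fn x‖ₑ := by
  constructor
  · rintro ⟨C, hC, h⟩
    refine ⟨C.toNNReal, Real.toNNReal_pos.2 hC, fun f => ?_⟩
    rcases eq_or_ne (⨆ x ∈ V, ‖f.fn x‖ₑ) ⊤ with htop | htop
    · rw [htop, ENNReal.mul_top (by simpa using hC)]
      exact le_top
    · have hb := h f (⨆ x ∈ V, ‖f.fn x‖ₑ).toReal ENNReal.toReal_nonneg fun x hx => by
        rw [← toReal_enorm]
        exact ENNReal.toReal_mono htop (le_iSup₂ (f := fun x (_ : x ∈ V) => ‖f.fn x‖ₑ) x hx)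
      refine (ENNReal.ofReal_le_ofReal hb).trans (le_of_eq ?_)
      rw [ENNReal.ofReal_mul hC.le, ENNReal.ofReal_toReal htop]
      rfl
  · rintro ⟨C, hC, h⟩
    refine ⟨C, hC, fun f B hB hf => ?_⟩
    have hs : (⨆ x ∈ V, ‖f.fn x‖ₑ) ≤ ENNReal.ofReal B := by
      refine iSup₂_le fun x hx => ?_
      rw [← ofReal_norm]
      exact ENNReal.ofReal_le_ofReal (hf x hx)
    have h1 : ENNReal.ofReal (q f) ≤ ENNReal.ofReal (C * B) := by
      rw [ENNReal.ofReal_mul C.coe_nonneg, ENNReal.ofReal_coe_nnreal]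
      exact (h f).trans (by gcongr)
    exact (ENNReal.ofReal_le_ofReal_iff (by positivity)).1 h1

theorem SupControlled.mono {q : Seminorm ℂ (Holo E)} {V W : Set E} (h : SupControlled q V)
    (hVW : V ⊆ W) : SupControlled q W := by
  obtain ⟨C, hC, h⟩ := h
  exact ⟨C, hC, fun f B hB hf => h f B hB fun x hx => hf x (hVW hx)⟩

theorem isPortedBy_iff {q : Seminorm ℂ (Holo E)} {K : Set E} :
    IsPortedBy q K ↔ ∀ V : Set E, IsOpen V → K ⊆ V → SupControlled q V := by
  simp only [IsPortedBy, supControlled_iff]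

theorem isDeltaContinuous_iff {q : Seminorm ℂ (Holo E)} :
    IsDeltaContinuous q ↔ ∀ V : ℕ → Set E, (∀ n, IsOpen (V n)) → Monotone V → ⋃ n, V n = univ →
      ∃ n, SupControlled q (V n) := by
  simp only [IsDeltaContinuous, supControlled_iff]

theorem exists_subset_of_isCompact {E : Type*} [TopologicalSpace E] {K : Set E} (hK : IsCompact K) {V : ℕ → Set E}
    (hV : ∀ n, IsOpen (V n)) (hm : Monotone V) (hU : ⋃ n, V n = univ) (m : ℕ) :
    ∃ n, m ≤ n ∧ K ⊆ V n := by
  obtain ⟨n, hn⟩ := hK.elim_directed_cover V hV (by simp [hU]) hm.directed_le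
  exact ⟨max m n, le_max_left _ _, hn.trans (hm (le_max_right _ _))⟩

theorem IsPortedBy.isDeltaContinuous {q : Seminorm ℂ (Holo E)} {K : Set E} (hK : IsCompact K)
    (h : IsPortedBy q K) : IsDeltaContinuous q := by
  rw [isDeltaContinuous_iff]
  intro V hV hm hU
  obtain ⟨n, -, hn⟩ := exists_subset_of_isCompact hK hV hm hU 0
  exact ⟨n, isPortedBy_iff.1 h _ (hV n) hn⟩

theorem tauDelta_le_tauOmega : tauDelta E ≤ tauOmega E :=
  topologyOfSeminorms_mono fun _ ⟨_, hK, h⟩ => h.isDeltaContinuous hK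

theorem eventually_tauZero (f : Holo E) {K : Set E} (hK : IsCompact K) {ε : ℝ} (hε : 0 < ε) :
    ∀ᶠ g in @nhds _ (tauZero E) f, ∀ x ∈ K, ‖(g - f).fn x‖ < ε := by
  let := tauZero E
  have hc : Continuous (Holo.toCM : Holo E → C(E, ℂ)) := continuous_induced_dom
  have := ContinuousMap.tendsto_iff_forall_isCompact_tendstoUniformlyOn.1 (hc.tendsto f) K hK
  rw [Metric.tendstoUniformlyOn_iff] at this
  filter_upwards [this ε hε] with g hg x hx
  have h := hg x hx
  rw [dist_comm, dist_eq_norm] at h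
  exact h

theorem tauZero_le_topologyOfSeminorms {Q : Set (Seminorm ℂ (Holo E))}
    (h : ∀ q ∈ Q, ∃ K, IsCompact K ∧ SupControlled q K) : tauZero E ≤ topologyOfSeminorms Q := by
  let := tauZero E
  refine continuous_id_iff_le.1 (continuous_iff_topologyOfSeminorms.2 fun f q hq ε hε => ?_)
  obtain ⟨K, hK, C, hC, hqK⟩ := h q hq
  filter_upwards [eventually_tauZero f hK (ε := ε / (2 * C)) (by positivity)] with g hg
  refine (hqK (g - f) (ε / (2 * C)) (by positivity) fun x hx => (hg x hx).le).trans_lt ?_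
  field_simp
  linarith

/-- The seminorm `f ↦ sup_K |f|` for a compact set `K`. -/
def supSeminorm {K : Set E} (hK : IsCompact K) : Seminorm ℂ (Holo E) :=
  have hb : ∀ f : Holo E, BddAbove (range fun x : K => ‖f.fn x‖) := fun f => by
    obtain ⟨M, hM⟩ := hK.exists_bound_of_continuousOn f.continuous.continuousOn
    exact ⟨M, by rintro _ ⟨x, rfl⟩; exact hM x x.2⟩
  Seminorm.of (fun f => ⨆ x : K, ‖f.fn x‖)
    (fun f g => Real.iSup_le (fun x => (norm_add_le _ _).trans
      (add_le_add (le_ciSup (hb f) x) (le_ciSup (hb g) x)))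
      (add_nonneg (Real.iSup_nonneg fun _ => norm_nonneg _) (Real.iSup_nonneg fun _ => norm_nonneg _)))
    (fun c f => by
      rw [Real.mul_iSup_of_nonneg (norm_nonneg c)]
      simp)

theorem le_supSeminorm {K : Set E} (hK : IsCompact K) (f : Holo E) {x : E} (hx : x ∈ K) :
    ‖f.fn x‖ ≤ supSeminorm hK f := by
  obtain ⟨M, hM⟩ := hK.exists_bound_of_continuousOn f.continuous.continuousOn
  exact le_ciSup (f := fun x : K => ‖f.fn x‖) ⟨M, by rintro _ ⟨x, rfl⟩; exact hM x x.2⟩ ⟨x, hx⟩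

theorem supControlled_supSeminorm {K : Set E} (hK : IsCompact K) :
    SupControlled (supSeminorm hK) K := by
  refine ⟨1, one_pos, fun f B hB hf => ?_⟩
  rw [one_mul]
  exact Real.iSup_le (fun x => hf x x.2) hB

theorem tauOmega_le_tauZero : tauOmega E ≤ tauZero E := by
  rw [tauZero, ← continuous_iff_le_induced]
  let := tauOmega E
  refine continuous_iff_continuousAt.2 fun f => ?_
  refine ContinuousMap.tendsto_iff_forall_isCompact_tendstoUniformlyOn.2 fun K hK => ?_
  rw [Metric.tendstoUniformlyOn_iff]
  intro ε hε
  have hQ : supSeminorm hK ∈ {q : Seminorm ℂ (Holo E) | ∃ K, IsCompact K ∧ IsPortedBy q K} :=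
    ⟨K, hK, isPortedBy_iff.2 fun V _ hV => (supControlled_supSeminorm hK).mono hV⟩
  filter_upwards [continuous_iff_topologyOfSeminorms.1 (continuous_id (X := Holo E)) f _ hQ ε hε]
    with g hg x hx
  rw [dist_comm, dist_eq_norm]
  exact (le_supSeminorm hK (g - f) hx).trans_lt hg

/-- Some neighbourhood of `0` on which `q < 1` contains all `f` with `|f| < ε` on `K`; rescale a
general `f` into it. -/
theorem exists_supControlled_of_continuous_tauZero {q : Seminorm ℂ (Holo E)}
    (hq : @Continuous _ _ (tauZero E) _ q) : ∃ K, IsCompact K ∧ SupControlled q K := by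
  let := tauZero E
  have h1 : ∀ᶠ f in 𝓝 (0 : Holo E), q f < 1 := (hq.tendsto 0).eventually_lt_const (by simp)
  rw [show 𝓝 (0 : Holo E) = comap Holo.toCM (𝓝 (Holo.toCM 0)) from nhds_induced _ _,
    eventually_comap] at h1
  have hb := nhds_basis_uniformity' (x := Holo.toCM (0 : Holo E))
    (Metric.uniformity_basis_dist (α := ℂ)).compactConvergenceUniformity
  obtain ⟨⟨K, ε⟩, ⟨hK, hε⟩, h2⟩ := hb.eventually_iff.1 h1
  dsimp only at hK hε h2
  have h3 : ∀ f : Holo E, (∀ x ∈ K, ‖f.fn x‖ < ε) → q f < 1 := fun f hf =>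
    @h2 (Holo.toCM f) (fun x hx => by
      have := hf x hx
      change dist (0 : ℂ) (f.fn x) < ε
      rwa [dist_zero_left]) f rfl
  refine ⟨K, hK, 2 / ε, by positivity, fun f B hB hf => ?_⟩
  -- The slack `η` keeps the rescaling factor meaningful when `B = 0`.
  refine le_of_forall_pos_le_add fun η hη => ?_
  have hB' : 0 < B + η * ε / 2 := by positivity
  have hpos : 0 < ε / (2 * (B + η * ε / 2)) := by positivity
  have h4 := h3 (((ε / (2 * (B + η * ε / 2)) : ℝ) : ℂ) • f) fun x hx => by
    rw [Holo.fn_smul, Pi.smul_apply, norm_smul, Complex.norm_real, Real.norm_of_nonneg hpos.le]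
    calc _ ≤ ε / (2 * (B + η * ε / 2)) * (B + η * ε / 2) := by
          gcongr; exact (hf x hx).trans (by linarith [show 0 < η * ε / 2 by positivity])
      _ = ε / 2 := by field_simp
      _ < ε := by linarith
  rw [map_smul_eq_mul, Complex.norm_real, Real.norm_of_nonneg hpos.le, div_mul_eq_mul_div,
    div_lt_one (by positivity)] at h4
  have e : 2 / ε * B + η = 2 * (B + η * ε / 2) / ε := by field_simp
  rw [e, le_div_iff₀ hε]
  linarith

variable [IsTopologicalAddGroup E]

@[simp] theorem translation_fn (a : E) (f : Holo E) (x : E) :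
    (translation a f).fn x = f.fn (x - a) := rfl

theorem translation_comm (a b : E) (f : Holo E) :
    translation a (translation b f) = translation b (translation a f) := by
  ext x
  simp [sub_right_comm]

theorem continuous_translation_tauZero (a : E) :
    Continuous[tauZero E, tauZero E] (translation a) := by
  let := tauZero E
  refine continuous_induced_rng.2 ?_
  have hc : Continuous (Holo.toCM : Holo E → C(E, ℂ)) := continuous_induced_dom
  exact (ContinuousMap.continuous_precomp (Z := ℂ)
    (⟨fun x => x - a, by fun_prop⟩ : C(E, E))).comp hc

/-- The translates of an increasing open cover form another one. -/
theorem continuous_translation_tauDelta (a : E) :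
    Continuous[tauDelta E, tauDelta E] (translation a) := by
  refine continuous_linearMap_of_comp_mem _ fun q hq => ?_
  rw [mem_ofPred_eq, isDeltaContinuous_iff] at hq ⊢
  intro V hV hm hU
  obtain ⟨n, C, hC, hn⟩ := hq (fun n => (fun x => x - a) ⁻¹' V n)
    (fun n => (hV n).preimage (by fun_prop)) (fun i j hij => preimage_mono (hm hij))
    (by rw [← preimage_iUnion, hU, preimage_univ])
  exact ⟨n, C, hC, fun f B hB hf => hn _ B hB fun x hx => hf _ hx⟩

end Generalities

/-! ### Holomorphic functions on `ℂ^ℕ` depend on finitely many variables -/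

section Sequences

/-- The function `f` on `ℂ^ℕ` depends on the first `n` coordinates only. -/
def DependsOnFirst (n : ℕ) (f : (ℕ → ℂ) → ℂ) : Prop :=
  ∀ x y : ℕ → ℂ, (∀ i < n, x i = y i) → f x = f y

theorem exists_cylinder_subset {V : Set (ℕ → ℂ)} (hV : IsOpen V) (h0 : 0 ∈ V) :
    ∃ (n : ℕ) (ε : ℝ), 0 < ε ∧ ∀ x : ℕ → ℂ, (∀ i < n, ‖x i‖ < ε) → x ∈ V := by
  obtain ⟨I, u, hu, hI⟩ := isOpen_pi_iff.1 hV 0 h0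
  have hex : ∀ i ∈ I, ∃ δ > 0, Metric.ball (0 : ℂ) δ ⊆ u i := fun i hi =>
    Metric.isOpen_iff.1 (hu i hi).1 0 (hu i hi).2
  choose! δ hδ hb using hex
  obtain ⟨ε, hε, hεδ⟩ : ∃ ε : ℝ, 0 < ε ∧ ∀ i ∈ I, ε ≤ δ i := by
    rcases I.eq_empty_or_nonempty with rfl | hne
    · exact ⟨1, one_pos, by simp⟩
    · exact ⟨I.inf' hne δ, (Finset.lt_inf'_iff hne).2 hδ, fun i hi => Finset.inf'_le δ hi⟩
  refine ⟨I.sup id + 1, ε, hε, fun x hx => hI fun i hi => hb i hi ?_⟩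
  rw [mem_ball_zero_iff]
  exact (hx i (Nat.lt_succ_of_le (Finset.le_sup (f := id) hi))).trans_le (hεδ i hi)

theorem dependsOnFirst_of_bounded {f : (ℕ → ℂ) → ℂ} (hf : f ∈ holoSubmodule (ℕ → ℂ)) {n : ℕ}
    {ε M : ℝ} (hε : 0 < ε) (hM : ∀ x : ℕ → ℂ, (∀ i < n, ‖x i‖ < ε) → ‖f x‖ ≤ M) :
    DependsOnFirst n f := by
  -- Liouville: the line `x + z • y` stays in the cylinder, where `f` is bounded.
  have hsmall : ∀ x y : ℕ → ℂ, (∀ i < n, ‖x i‖ < ε) → (∀ i < n, y i = 0) → f (x + y) = f x := by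
    intro x y hx hy
    have := (hf.2 x y).apply_eq_apply_of_bounded (isBounded_iff_forall_norm_le.2 ⟨M, ?_⟩) 1 0
    · simpa using this
    · rintro _ ⟨z, rfl⟩
      exact hM _ fun i hi => by simpa [hy i hi] using hx i hi
  intro x w hxw
  have hy : ∀ i < n, (w - x) i = 0 := fun i hi => by simp [hxw i hi]
  -- For small `t` the point `t • x` lies in the cylinder, so this vanishes near `0`, hence also at
  -- `t = 1`.
  have hφ : Differentiable ℂ fun t : ℂ => f ((w - x) + t • x) - f (0 + t • x) :=
    (hf.2 (w - x) x).sub (hf.2 0 x)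
  have han : AnalyticOnNhd ℂ (fun t : ℂ => f ((w - x) + t • x) - f (0 + t • x)) univ :=
    Complex.analyticOnNhd_univ_iff_differentiable.2 hφ
  have hz : (fun t : ℂ => f ((w - x) + t • x) - f (0 + t • x)) =ᶠ[𝓝 0] 0 := by
    have hopen : ∀ i ∈ Finset.range n, ∀ᶠ t : ℂ in 𝓝 0, ‖t * x i‖ < ε := fun i _ => by
      have hc : Continuous fun t : ℂ => ‖t * x i‖ := by fun_prop
      exact (hc.tendsto 0).eventually_lt_const (by simpa using hε)
    filter_upwards [(eventually_all_finset _).2 hopen] with t ht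
    have := hsmall (t • x) (w - x) (fun i hi => by simpa using ht i (Finset.mem_range.2 hi)) hy
    simp [add_comm (w - x), this]
  have h1 := han.eqOn_zero_of_preconnected_of_eventuallyEq_zero isPreconnected_univ (mem_univ 0) hz
    (mem_univ 1)
  have h2 : f w - f x = 0 := by simpa using h1
  exact (sub_eq_zero.1 h2).symm

theorem exists_dependsOnFirst {f : (ℕ → ℂ) → ℂ} (hf : f ∈ holoSubmodule (ℕ → ℂ)) :
    ∃ n, DependsOnFirst n f := by
  obtain ⟨n, ε, hε, h⟩ := exists_cylinder_subset (V := {x | ‖f x‖ < ‖f 0‖ + 1})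
    (isOpen_lt hf.1.norm continuous_const) (by simp)
  exact ⟨n, dependsOnFirst_of_bounded hf hε fun x hx => (h x hx).le⟩

/-- All holomorphic functions which are bounded on the members of an increasing open cover, from
some member on, depend on a fixed number of coordinates. -/
theorem exists_dependsOnFirst_of_cover {V : ℕ → Set (ℕ → ℂ)} (hV : ∀ n, IsOpen (V n))
    (hm : Monotone V) (hU : ⋃ n, V n = univ) :
    ∃ m k : ℕ, ∀ n, m ≤ n → ∀ (f : Holo (ℕ → ℂ)) (B : ℝ), (∀ x ∈ V n, ‖f.fn x‖ ≤ B) →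
      DependsOnFirst k f.fn := by
  obtain ⟨m, hm0⟩ := mem_iUnion.1 (hU ▸ mem_univ (0 : ℕ → ℂ))
  obtain ⟨k, ε, hε, h⟩ := exists_cylinder_subset (hV m) hm0
  exact ⟨m, k, fun n hn f B hB => dependsOnFirst_of_bounded f.2 hε fun x hx =>
    hB x (hm hn (h x hx))⟩

/-- Only functions bounded on `V n` need testing. From stage `m` on they share one `k`, and some
later `V n` contains the compact set attached to that `k`. -/
theorem isDeltaContinuous_of_dependsOnFirst {q : Seminorm ℂ (Holo (ℕ → ℂ))}
    (h : ∀ k : ℕ, ∃ K, IsCompact K ∧ ∃ C : ℝ, 0 < C ∧ ∀ f : Holo (ℕ → ℂ), DependsOnFirst k f.fn →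
      ∀ B : ℝ, 0 ≤ B → (∀ x ∈ K, ‖f.fn x‖ ≤ B) → q f ≤ C * B) : IsDeltaContinuous q := by
  rw [isDeltaContinuous_iff]
  intro V hV hm hU
  obtain ⟨m, k, hk⟩ := exists_dependsOnFirst_of_cover hV hm hU
  obtain ⟨K, hK, C, hC, hq⟩ := h k
  obtain ⟨n, hmn, hn⟩ := exists_subset_of_isCompact hK hV hm hU m
  exact ⟨n, C, hC, fun f B hB hf => hq f (hk n hmn f B hf) B hB fun x hx => hf x (hn hx)⟩

/-! ### The compact-open and the compact-ported topologies of `H(ℂ^ℕ)` coincide -/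

/-- The projection of `ℂ^ℕ` onto the first `n` coordinates. -/
def truncL (n : ℕ) : (ℕ → ℂ) →L[ℂ] (ℕ → ℂ) :=
  ContinuousLinearMap.pi fun i => if i < n then ContinuousLinearMap.proj i else 0

theorem truncL_apply (n : ℕ) (x : ℕ → ℂ) (i : ℕ) : truncL n x i = if i < n then x i else 0 := by
  by_cases h : i < n <;> simp [truncL, h]

/-- Composition of a holomorphic function with a continuous linear map. -/
def Holo.comp {E : Type*} [AddCommGroup E] [Module ℂ E] [TopologicalSpace E] (f : Holo E)
    (T : E →L[ℂ] E) : Holo E :=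
  ⟨fun x => f.fn (T x), f.continuous.comp T.continuous, fun a b => by
    have h := f.2.2 (T a) (T b)
    simp only [map_add, map_smul]
    exact h⟩

@[simp] theorem Holo.comp_fn {E : Type*} [AddCommGroup E] [Module ℂ E] [TopologicalSpace E]
    (f : Holo E) (T : E →L[ℂ] E) (x : E) : (f.comp T).fn x = f.fn (T x) := rfl

theorem Holo.comp_truncL {f : Holo (ℕ → ℂ)} {n : ℕ} (hf : DependsOnFirst n f.fn) :
    f.comp (truncL n) = f := by
  ext x
  exact hf _ _ fun i hi => by simp [truncL_apply, hi]

theorem truncL_succ (n : ℕ) (x : ℕ → ℂ) :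
    truncL (n + 1) x = truncL n x + x n • Pi.single n 1 := by
  funext i
  simp only [truncL_apply, Pi.add_apply, Pi.smul_apply, smul_eq_mul, Pi.single_apply]
  rcases lt_trichotomy i n with h | rfl | h
  · simp [h, h.ne, h.trans (Nat.lt_succ_self n)]
  · simp
  · simp [h.ne', not_lt.2 h.le, not_lt.2 (Nat.succ_le_of_lt h)]

theorem truncL_zero_apply (x : ℕ → ℂ) : truncL 0 x = 0 := by
  funext i; simp [truncL_apply]

theorem seminorm_comp_truncL_le (q : Seminorm ℂ (Holo (ℕ → ℂ))) (f : Holo (ℕ → ℂ)) (n : ℕ) :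
    q (f.comp (truncL n)) ≤ q (f.comp (truncL 0)) +
      ∑ i ∈ Finset.range n, q (f.comp (truncL (i + 1)) - f.comp (truncL i)) := by
  induction n with
  | zero => simp
  | succ n ih =>
    rw [Finset.sum_range_succ, ← add_assoc]
    have h := map_add_le_add q (f.comp (truncL n))
      (f.comp (truncL (n + 1)) - f.comp (truncL n))
    rw [add_sub_cancel] at h
    linarith

/-- Portedness gives a constant `C n` for each open cylinder around `K`, with no control on its
growth; enlarging the `n`-th radius compensates for `C (n + 1)`. -/
theorem IsPortedBy.exists_supControlled {q : Seminorm ℂ (Holo (ℕ → ℂ))} {K : Set (ℕ → ℂ)}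
    (hK : IsCompact K) (h : IsPortedBy q K) : ∃ K', IsCompact K' ∧ SupControlled q K' := by
  have hr : ∀ i : ℕ, ∃ s : ℝ, 0 < s ∧ ∀ x ∈ K, ‖x i‖ < s := fun i => by
    obtain ⟨M, hM⟩ := hK.exists_bound_of_continuousOn (continuous_apply i).continuousOn
    exact ⟨|M| + 1, by positivity, fun x hx => ((hM x hx).trans (le_abs_self M)).trans_lt (by simp)⟩
  choose s hs hsK using hr
  have hopen : ∀ n : ℕ, IsOpen {x : ℕ → ℂ | ∀ i ∈ Finset.range n, ‖x i‖ < s i} := fun n => by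
    simp only [ofPred_forall]
    exact isOpen_biInter_finset fun i _ => isOpen_lt (continuous_apply i).norm continuous_const
  have hC := fun n => isPortedBy_iff.1 h _ (hopen n) fun x hx i _ => hsK i x hx
  choose C hC0 hC using hC
  -- Chosen so that `C (n + 1) * (2 * B / R n * s n) ≤ 2⁻ⁿ * B`, with `R n ≥ s n`.
  let R : ℕ → ℝ := fun n => s n * (1 + 2 * 2 ^ n * C (n + 1))
  have hsR : ∀ n, s n ≤ R n := fun n => by
    have := hC0 (n + 1)
    exact le_mul_of_one_le_right (hs n).le (by simp; positivity)
  have hR0 : ∀ n, 0 < R n := fun n => (hs n).trans_le (hsR n)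
  -- `C 0` pays for the constant term `f 0`, and `2` for the geometric series of increments.
  refine ⟨univ.pi fun i => Metric.closedBall 0 (R i),
    isCompact_univ_pi fun i => isCompact_closedBall _ _, C 0 + 2, by linarith [hC0 0], ?_⟩
  intro f B hB hf
  have hf' : ∀ x : ℕ → ℂ, (∀ i, ‖x i‖ ≤ R i) → ‖f.fn x‖ ≤ B := fun x hx =>
    hf x fun i _ => by simpa using hx i
  have h0 : q (f.comp (truncL 0)) ≤ C 0 * B := hC 0 _ B hB fun x _ => by
    rw [Holo.comp_fn, truncL_zero_apply]
    exact hf' _ fun i => by simpa using (hR0 i).le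
  have hstep : ∀ n, q (f.comp (truncL (n + 1)) - f.comp (truncL n)) ≤ (1 / 2) ^ n * B := by
    intro n
    have hb : ∀ x ∈ {x : ℕ → ℂ | ∀ i ∈ Finset.range (n + 1), ‖x i‖ < s i},
        ‖(f.comp (truncL (n + 1)) - f.comp (truncL n)).fn x‖ ≤ 2 * B / R n * s n := by
      intro x hx
      have hbd : ∀ z : ℂ, ‖z‖ ≤ R n →
          ‖f.fn (truncL n x + z • Pi.single n 1)‖ ≤ B := fun z hz => hf' _ fun i => by
        simp only [truncL_apply, Pi.add_apply, Pi.smul_apply, smul_eq_mul, Pi.single_apply]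
        rcases lt_trichotomy i n with hi | rfl | hi
        · simpa [hi, hi.ne] using
            (hx i (Finset.mem_range.2 (hi.trans (Nat.lt_succ_self n)))).le.trans (hsR i)
        · simpa using hz
        · simpa [hi.ne', not_lt.2 hi.le] using (hR0 i).le
      have hxn : ‖x n‖ < s n := hx n (by simp)
      -- Schwarz lemma in coordinate `n`: the slice maps the disc of radius `R n` into a disc of
      -- radius `2 * B` about its value at `0`, and `‖x n‖ < s n`.
      have hd := Complex.dist_le_div_mul_dist_of_mapsTo_ball (c := (0 : ℂ)) (z := x n)
        (R₁ := R n) (R₂ := 2 * B) (f.2.2 (truncL n x) (Pi.single n 1)).differentiableOn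
        (fun z hz => ?_) (by simpa using hxn.trans_le (hsR n))
      · rw [dist_eq_norm, dist_zero_right, zero_smul, add_zero, ← truncL_succ] at hd
        refine hd.trans ?_
        have := hR0 n
        gcongr
      · rw [mem_closedBall_iff_norm]
        have h1 := hbd z (by simpa using (mem_ball_zero_iff.1 hz).le)
        have h2 := hbd 0 (by simpa using (hR0 n).le)
        refine (norm_sub_le _ _).trans ?_
        rw [two_mul]
        exact add_le_add h1 h2
    have hpos := hR0 n
    have hsn := hs n
    refine (hC (n + 1) _ _ (by positivity) hb).trans ?_
    have hCn := hC0 (n + 1)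
    have e : C (n + 1) * (2 * B / R n * s n) =
        (2 * C (n + 1) / (1 + 2 * 2 ^ n * C (n + 1))) * B := by
      simp only [R]
      field_simp
    rw [e]
    refine mul_le_mul_of_nonneg_right ?_ hB
    rw [div_le_iff₀ (by positivity), one_div, inv_pow, mul_add, mul_one]
    have e2 : ((2 : ℝ) ^ n)⁻¹ * (2 * 2 ^ n * C (n + 1)) = 2 * C (n + 1) := by field_simp
    rw [e2]
    have : (0 : ℝ) < ((2 : ℝ) ^ n)⁻¹ := by positivity
    linarith
  obtain ⟨N, hN⟩ := exists_dependsOnFirst f.2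
  have hsum := seminorm_comp_truncL_le q f N
  rw [Holo.comp_truncL hN] at hsum
  have hgeo : ∑ i ∈ Finset.range N, q (f.comp (truncL (i + 1)) - f.comp (truncL i)) ≤ 2 * B := by
    refine (Finset.sum_le_sum fun i _ => hstep i).trans ?_
    rw [← Finset.sum_mul]
    exact mul_le_mul_of_nonneg_right (sum_geometric_two_le N) hB
  linarith

theorem tauZero_eq_tauOmega : tauZero (ℕ → ℂ) = tauOmega (ℕ → ℂ) :=
  le_antisymm (tauZero_le_topologyOfSeminorms fun _ ⟨_, hK, h⟩ => h.exists_supControlled hK)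
    tauOmega_le_tauZero

/-! ### The compact-open topology of `H(ℂ^ℕ)` is not bornological -/

theorem summable_of_eventually_zero {a : ℕ → ℝ} (k : ℕ) (h : ∀ n, k ≤ n → a n = 0) : Summable a :=
  summable_of_ne_finset_zero (s := Finset.range k) fun n hn => h n (by simpa using hn)

theorem single_difference_eq_zero {f : (ℕ → ℂ) → ℂ} {k n : ℕ} (hf : DependsOnFirst k f)
    (hn : k ≤ n) (x : ℕ → ℂ) : ‖f (x + Pi.single n 1) - f x‖ = 0 := by
  rw [hf (x + Pi.single n 1) x fun i hi => by simp [(hi.trans_le hn).ne],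
    sub_self, norm_zero]

/-- The seminorm `f ↦ ∑ₙ |f (n e₀ + eₙ) - f (n e₀)|`. -/
def diffSeminorm : Seminorm ℂ (Holo (ℕ → ℂ)) :=
  have hs : ∀ f : Holo (ℕ → ℂ), Summable fun n : ℕ =>
      ‖f.fn (Pi.single 0 (n : ℂ) + Pi.single n 1) - f.fn (Pi.single 0 (n : ℂ))‖ := fun f => by
    obtain ⟨k, hk⟩ := exists_dependsOnFirst f.2
    exact summable_of_eventually_zero k fun n hn => single_difference_eq_zero hk hn _
  Seminorm.of (fun f => ∑' n : ℕ,
      ‖f.fn (Pi.single 0 (n : ℂ) + Pi.single n 1) - f.fn (Pi.single 0 (n : ℂ))‖)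
    (fun f g => by
      rw [← (hs f).tsum_add (hs g)]
      refine (hs (f + g)).tsum_le_tsum (fun n => ?_) ((hs f).add (hs g))
      rw [Holo.fn_add, Pi.add_apply, Pi.add_apply, add_sub_add_comm]
      exact norm_add_le _ _)
    (fun c f => by
      rw [← tsum_mul_left]
      refine tsum_congr fun n => ?_
      rw [Holo.fn_smul, Pi.smul_apply, Pi.smul_apply, ← smul_sub, norm_smul])

theorem diffSeminorm_eq_sum {f : Holo (ℕ → ℂ)} {k : ℕ} (hf : DependsOnFirst k f.fn) :
    diffSeminorm f = ∑ n ∈ Finset.range k,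
      ‖f.fn (Pi.single 0 (n : ℂ) + Pi.single n 1) - f.fn (Pi.single 0 (n : ℂ))‖ :=
  tsum_eq_sum fun n hn => single_difference_eq_zero hf (by simpa using hn) _

/-- On functions of `k` variables only `k` differences survive, so a finite set controls the
seminorm. -/
theorem isDeltaContinuous_diffSeminorm : IsDeltaContinuous diffSeminorm := by
  refine isDeltaContinuous_of_dependsOnFirst fun k => ?_
  refine ⟨(fun n : ℕ => (Pi.single 0 (n : ℂ) + Pi.single n 1 : ℕ → ℂ)) '' (Finset.range k) ∪
    (fun n : ℕ => (Pi.single 0 (n : ℂ) : ℕ → ℂ)) '' (Finset.range k),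
    (((Finset.finite_toSet _).image _).union ((Finset.finite_toSet _).image _)).isCompact,
    -- The `+ 1` only keeps the constant positive when `k = 0`.
    2 * k + 1, by positivity, fun f hf B hB hb => ?_⟩
  rw [diffSeminorm_eq_sum hf]
  have : ∀ n ∈ Finset.range k,
      ‖f.fn (Pi.single 0 (n : ℂ) + Pi.single n 1) - f.fn (Pi.single 0 (n : ℂ))‖ ≤ 2 * B := by
    intro n hn
    have h1 := hb _ (Or.inl (mem_image_of_mem _ hn))
    have h2 := hb _ (Or.inr (mem_image_of_mem _ hn))
    exact (norm_sub_le _ _).trans (by linarith)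
  refine (Finset.sum_le_card_nsmul _ _ _ this).trans ?_
  rw [Finset.card_range, nsmul_eq_mul]
  nlinarith

/-- The monomial `x ↦ x₀ʲ xₙ`. -/
def monomialHolo (j n : ℕ) : Holo (ℕ → ℂ) :=
  ⟨fun x => x 0 ^ j * x n, by fun_prop, fun a b => by
    simp only [Pi.add_apply, Pi.smul_apply]
    fun_prop⟩

theorem monomialHolo_fn (j n : ℕ) (x : ℕ → ℂ) : (monomialHolo j n).fn x = x 0 ^ j * x n := rfl

theorem le_diffSeminorm_monomialHolo (j : ℕ) {n : ℕ} (hn : 0 < n) :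
    (n : ℝ) ^ j ≤ diffSeminorm (monomialHolo j n) := by
  have hd : DependsOnFirst (n + 1) (monomialHolo j n).fn := fun x y hxy => by
    rw [monomialHolo_fn, monomialHolo_fn, hxy 0 (Nat.succ_pos n), hxy n (Nat.lt_succ_self n)]
  rw [diffSeminorm_eq_sum hd]
  refine le_trans (le_of_eq ?_) (Finset.single_le_sum (fun i _ => norm_nonneg _)
    (Finset.mem_range.2 (Nat.lt_succ_self n)))
  simp [monomialHolo_fn, hn.ne', hn.ne]

/-- Otherwise `diffSeminorm` is bounded by `C * sup_K`. Fix `n` beyond the size of `x 0` on `K`: on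
`x₀ʲ xₙ` the seminorm grows at least like `n ^ j`, the supremum at most like `(|R| + 1) ^ j`. -/
theorem tauZero_ne_tauDelta : tauZero (ℕ → ℂ) ≠ tauDelta (ℕ → ℂ) := by
  intro heq
  have hc : @Continuous _ _ (tauDelta (ℕ → ℂ)) _ diffSeminorm :=
    continuous_topologyOfSeminorms_of_mem isDeltaContinuous_diffSeminorm
  rw [← heq] at hc
  obtain ⟨K, hK, C, hC, h⟩ := exists_supControlled_of_continuous_tauZero hc
  obtain ⟨R, hR⟩ := hK.exists_bound_of_continuousOn (continuous_apply 0).continuousOn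
  obtain ⟨n, hn⟩ := exists_nat_gt (|R| + 1)
  have hn0 : 0 < n := by
    have : (0 : ℝ) < n := by linarith [abs_nonneg R]
    exact_mod_cast this
  obtain ⟨S, hS⟩ := hK.exists_bound_of_continuousOn (continuous_apply n).continuousOn
  have hbound : ∀ j : ℕ, (n : ℝ) ^ j ≤ C * ((|R| + 1) ^ j * |S|) := fun j => by
    refine (le_diffSeminorm_monomialHolo j hn0).trans (h _ _ (by positivity) fun x hx => ?_)
    rw [monomialHolo_fn, norm_mul, norm_pow]
    have h1 := hR x hx
    have h2 := hS x hx
    gcongr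
    · linarith [le_abs_self R]
    · linarith [le_abs_self S]
  have hR1 : 0 < |R| + 1 := by positivity
  have hgt : 1 < (n : ℝ) / (|R| + 1) := (one_lt_div hR1).2 hn
  obtain ⟨j, hj⟩ := pow_unbounded_of_one_lt (C * |S|) hgt
  have := hbound j
  rw [div_pow, lt_div_iff₀ (by positivity)] at hj
  linarith [show C * ((|R| + 1) ^ j * |S|) = C * |S| * (|R| + 1) ^ j by ring]

/-! ### Translations are not hypercyclic -/

theorem not_isHypercyclic_tauZero (a : ℕ → ℂ) :
    ¬ IsHypercyclic (tauZero (ℕ → ℂ)) (translation a) := by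
  rintro ⟨f, hf⟩
  obtain ⟨n, hn⟩ := exists_dependsOnFirst f.2
  have hinv : ∀ g : Holo (ℕ → ℂ), DependsOnFirst n g.fn → DependsOnFirst n (translation a g).fn :=
    fun g hg x y hxy => hg _ _ fun i hi => by simp [hxy i hi]
  have horb : ∀ k : ℕ, DependsOnFirst n ((translation a ^ k) f).fn := fun k => by
    induction k with
    | zero => exact hn
    | succ k ih =>
      rw [pow_succ', Module.End.mul_apply]
      exact hinv _ ih
  let := tauZero (ℕ → ℂ)
  -- Orbit elements agree at these two points while `xₙ` differs by `1` there, so none is within `1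
  -- / 2` of `xₙ` at both.
  have hK : IsCompact ({0, Pi.single n 1} : Set (ℕ → ℂ)) := (toFinite _).isCompact
  have hev := eventually_tauZero (monomialHolo 0 n) hK (ε := 1 / 2) (by norm_num)
  obtain ⟨_, hg, ⟨k, rfl⟩⟩ := mem_closure_iff_nhds.1 (hf (monomialHolo 0 n)) _ hev
  have h0 := hg 0 (by simp)
  have h1 := hg (Pi.single n 1) (by simp)
  have e := horb k (Pi.single n 1) 0 fun i hi => by simp [hi.ne]
  have es : ∀ x, (((translation a ^ k) f) - monomialHolo 0 n).fn x =
      ((translation a ^ k) f).fn x - (monomialHolo 0 n).fn x := fun x => rfl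
  dsimp only at h0 h1
  rw [es, monomialHolo_fn] at h0 h1
  rw [e] at h1
  simp only [Pi.zero_apply, mul_zero, sub_zero, pow_zero, one_mul, Pi.single_eq_same] at h0 h1
  have := norm_sub_le (((translation a ^ k) f).fn 0) (((translation a ^ k) f).fn 0 - 1)
  rw [sub_sub_cancel, norm_one] at this
  linarith

theorem not_isHypercyclic_of_le {τ : TopologicalSpace (Holo (ℕ → ℂ))}
    (h : τ ≤ tauZero (ℕ → ℂ)) (a : ℕ → ℂ) : ¬ IsHypercyclic τ (translation a) := by
  rintro ⟨f, hf⟩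
  exact not_isHypercyclic_tauZero a ⟨f, fun g => closure.mono h (hf g)⟩

end Sequences

/-! ### Cauchy estimates in `H_b(X)` -/

section BoundedType

variable {X : Type*} [NormedAddCommGroup X] [NormedSpace ℂ X]

theorem taylorNorm_le_of_bound {g : X → ℂ} (hg : AnalyticOnNhd ℂ g univ) {R M : ℝ} (hR : 0 < R)
    (hM : ∀ y : X, ‖y‖ ≤ R → ‖g y‖ ≤ M) (m : ℕ) : taylorNorm g m ≤ m.factorial * M / R ^ m :=
  taylorNorm_le _ _ fun _ hx => norm_iteratedFDeriv_line_le (fun _ => hg.contDiff) hR hM m hx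

/-- A bound on the ball of twice the radius leaves a geometric factor, which sums to `2`. -/
theorem taylorNorm_term_le {g : X → ℂ} (hg : AnalyticOnNhd ℂ g univ) {ρ M : ℝ} (hρ : 0 < ρ)
    (hM : ∀ y : X, ‖y‖ ≤ 2 * ρ → ‖g y‖ ≤ M) (m : ℕ) :
    ρ ^ m / m.factorial * taylorNorm g m ≤ M * (1 / 2) ^ m := by
  have h := taylorNorm_le_of_bound hg (by positivity) hM m
  have hfac : (0 : ℝ) < m.factorial := by exact_mod_cast m.factorial_pos
  calc ρ ^ m / m.factorial * taylorNorm g m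
      ≤ ρ ^ m / m.factorial * (m.factorial * M / (2 * ρ) ^ m) := by gcongr
    _ = M * (1 / 2) ^ m := by
      rw [mul_pow, one_div, inv_pow]
      field_simp

theorem hbSeminorm_apply (ρ : {ρ : ℝ // 0 < ρ}) (g : Hb X) :
    hbSeminorm ρ g = ∑' m : ℕ, (ρ : ℝ) ^ m / m.factorial * taylorNorm g.fn m := rfl

theorem hbSeminorm_le (ρ : {ρ : ℝ // 0 < ρ}) (g : Hb X) {M : ℝ}
    (hM : ∀ y : X, ‖y‖ ≤ 2 * ρ → ‖g.fn y‖ ≤ M) : hbSeminorm ρ g ≤ 2 * M := by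
  rw [hbSeminorm_apply]
  refine (((isBoundedType_iff.1 g.isBoundedType).2 ρ ρ.2).tsum_le_tsum
    (taylorNorm_term_le g.isBoundedType.1 ρ.2 hM) (summable_geometric_two.mul_left M)).trans ?_
  rw [tsum_mul_left, tsum_geometric_two, mul_comm]

theorem hbSeminorm_mono : Monotone (hbSeminorm (X := X)) := fun ρ σ h g => by
  refine ((isBoundedType_iff.1 g.isBoundedType).2 ρ ρ.2).tsum_le_tsum (fun m => ?_)
    ((isBoundedType_iff.1 g.isBoundedType).2 σ σ.2)
  have h1 := taylorNorm_nonneg g.fn m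
  have h2 : (ρ : ℝ) ≤ σ := h
  have h3 := ρ.2.le
  gcongr

theorem norm_le_hbSeminorm (ρ : {ρ : ℝ // 0 < ρ}) (g : Hb X) {y : X} (hy : ‖y‖ ≤ ρ) :
    ‖g.fn y‖ ≤ hbSeminorm ρ g := by
  have hρ := ρ.2
  have hs := hasSum_taylor (fun n => g.isBoundedType.1.contDiff (n := n)) 0 y
  rw [zero_add] at hs
  rw [← hs.tsum_eq]
  have hterm : ∀ m : ℕ, ‖(m.factorial : ℂ)⁻¹ * iteratedFDeriv ℂ m g.fn 0 fun _ => y‖ ≤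
      (ρ : ℝ) ^ m / m.factorial * taylorNorm g.fn m := by
    intro m
    have hρ' : ((ρ : ℝ) : ℂ) ≠ 0 := by exact_mod_cast hρ.ne'
    have hu : ‖(((ρ : ℝ) : ℂ)⁻¹ • y)‖ ≤ 1 := by
      rw [norm_smul, norm_inv, Complex.norm_real, Real.norm_of_nonneg hρ.le,
        inv_mul_le_iff₀ hρ, mul_one]
      exact hy
    have e : (iteratedFDeriv ℂ m g.fn 0 fun _ => y) =
        ((ρ : ℝ) : ℂ) ^ m * iteratedFDeriv ℂ m g.fn 0 fun _ => ((ρ : ℝ) : ℂ)⁻¹ • y := by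
      have := (iteratedFDeriv ℂ m g.fn 0).map_smul_univ (fun _ => ((ρ : ℝ) : ℂ))
        (fun _ => ((ρ : ℝ) : ℂ)⁻¹ • y)
      simpa [smul_smul, mul_inv_cancel₀ hρ'] using this
    rw [e, norm_mul, norm_mul, norm_inv, norm_pow, Complex.norm_natCast, Complex.norm_real,
      Real.norm_of_nonneg hρ.le, ← mul_assoc, div_eq_inv_mul]
    gcongr
    exact le_taylorNorm g.fn m hu
  exact tsum_of_norm_bounded ((isBoundedType_iff.1 g.isBoundedType).2 ρ ρ.2).hasSum hterm

theorem isBoundedType_of_mem_holoSubmodule [FiniteDimensional ℂ X] {g : X → ℂ}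
    (hg : g ∈ holoSubmodule X) : IsBoundedType X g := by
  have han := analyticOnNhd_of_mem_holoSubmodule hg
  refine isBoundedType_iff.2 ⟨han, fun ρ hρ => ?_⟩
  obtain ⟨M, -, hM⟩ := exists_bound_closedBall hg.1 (2 * ρ)
  exact Summable.of_nonneg_of_le (fun m => mul_nonneg (by positivity) (taylorNorm_nonneg _ m))
    (taylorNorm_term_le han hρ hM) (summable_geometric_two.mul_left M)

theorem withSeminorms_hbTopology :
    @WithSeminorms ℂ (Hb X) {ρ : ℝ // 0 < ρ} _ _ _ (fun ρ => hbSeminorm ρ) (hbTopology X) :=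
  @WithSeminorms.mk ℂ (Hb X) {ρ : ℝ // 0 < ρ} _ _ _ _ (hbTopology X) rfl

/-- The seminorms increase with `ρ`, so the largest radius dominates a finite family. -/
theorem exists_le_hbSeminorm {q : Seminorm ℂ (Hb X)} (hq : @Continuous _ _ (hbTopology X) _ q) :
    ∃ (C : ℝ) (ρ : {ρ : ℝ // 0 < ρ}), 0 < C ∧ ∀ g, q g ≤ C * hbSeminorm ρ g := by
  obtain ⟨s, C, hC, h⟩ := @Seminorm.bound_of_continuous _ _ _ _ _ _ _ (hbTopology X)
    withSeminorms_hbTopology q hq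
  have : Nonempty {ρ : ℝ // 0 < ρ} := ⟨⟨1, one_pos⟩⟩
  obtain ⟨ρ, hρ⟩ := s.exists_le
  refine ⟨C, ρ, by exact_mod_cast pos_iff_ne_zero.2 hC, fun g => (h g).trans ?_⟩
  have hsup : s.sup (fun ρ => (hbSeminorm ρ : Seminorm ℂ (Hb X))) ≤ hbSeminorm ρ :=
    Finset.sup_le fun σ hσ => hbSeminorm_mono (hρ σ hσ)
  exact mul_le_mul_of_nonneg_left (hsup g) C.coe_nonneg

end BoundedType

/-! ### The bornological topology and the inductive topology -/

section Inductive

variable {E : Type*} [AddCommGroup E] [Module ℂ E] [TopologicalSpace E] [IsTopologicalAddGroup E]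

/-- Test `q` on the cover by the `p`-balls of radius `n + 1`, where `‖g‖_{n+1}` bounds `g ∘ π_p`. -/
theorem exists_piStar_le {q : Seminorm ℂ (Holo E)} (hq : IsDeltaContinuous q)
    (p : {p : Seminorm ℂ E // Continuous p}) : ∃ (C : ℝ) (ρ : {ρ : ℝ // 0 < ρ}), 0 < C ∧
      ∀ g, q (piStar p g : hubSubmodule E) ≤ C * hbSeminorm ρ g := by
  obtain ⟨n, C, hC, h⟩ := isDeltaContinuous_iff.1 hq (fun n => {x | p.1 x < (n : ℝ) + 1})
    (fun n => isOpen_lt p.2 continuous_const)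
    (fun i j hij x (hx : p.1 x < (i : ℝ) + 1) => by
      have : (i : ℝ) ≤ j := by exact_mod_cast hij
      exact hx.trans_le (by linarith))
    (eq_univ_of_forall fun x => by
      obtain ⟨n, hn⟩ := exists_nat_gt (p.1 x)
      exact mem_iUnion.2 ⟨n, hn.trans (lt_add_one _)⟩)
  refine ⟨C, ⟨(n : ℝ) + 1, by positivity⟩, hC, fun g => h _ _ (apply_nonneg _ _) fun x hx => ?_⟩
  exact norm_le_hbSeminorm _ g (le_of_lt hx)

theorem continuous_piStar_tauDelta (p : {p : Seminorm ℂ E // Continuous p}) :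
    Continuous[hbTopology _, TopologicalSpace.induced Subtype.val (tauDelta E)] (piStar p) := by
  let := hbTopology (NormedQuot p.1)
  refine continuous_induced_rng.2 (continuous_iff_topologyOfSeminorms.2 fun g q hq ε hε => ?_)
  obtain ⟨C, ρ, hC, h⟩ := exists_piStar_le hq p
  have hT := (withSeminorms_hbTopology (X := NormedQuot p.1)).tendsto_nhds id g |>.1 tendsto_id ρ
    (ε / C) (by positivity)
  filter_upwards [hT] with z hz
  have e : ((piStar p z : hubSubmodule E) : Holo E) - (piStar p g : hubSubmodule E) =
      (piStar p (z - g) : hubSubmodule E) := by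
    rw [map_sub]; rfl
  rw [Function.comp_apply, Function.comp_apply, e]
  refine (h _).trans_lt ?_
  rwa [lt_div_iff₀ hC, mul_comm] at hz

/-- `τ_δ` itself competes in the infimum defining the inductive topology. -/
theorem hubTopology_le_induced_tauDelta :
    hubTopology E ≤ TopologicalSpace.induced Subtype.val (tauDelta E) := by
  let := tauDelta E
  have hw := (hubSubmodule E).subtype.withSeminorms_induced
    (withSeminorms_topologyOfSeminorms {q : Seminorm ℂ (Holo E) | IsDeltaContinuous q})
  let := TopologicalSpace.induced (hubSubmodule E).subtype (tauDelta E)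
  exact sInf_le ⟨hw.topologicalAddGroup, hw.continuousSMul, hw.toLocallyConvexSpace,
    continuous_piStar_tauDelta⟩

theorem tendsto_of_forall_continuous_seminorm {X Y : Type*} [AddCommGroup X] [Module ℂ X]
    [TopologicalSpace X] [IsTopologicalAddGroup X] [ContinuousSMul ℂ X] [LocallyConvexSpace ℝ X]
    {u : Y → X} {l : Filter Y} {x : X}
    (h : ∀ q : Seminorm ℂ X, Continuous q → ∀ ε : ℝ, 0 < ε → ∀ᶠ y in l, q (u y - x) < ε) :
    Tendsto u l (𝓝 x) := by
  -- The gauge family is formed over `ℂ`, so local convexity is transferred from `ℝ`.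
  open scoped ComplexOrder in
  have : LocallyConvexSpace ℂ X := .ofBasisZero ℂ X _ _
    (LocallyConvexSpace.convex_basis_zero ℝ X) fun s hs => convex_RCLike_iff_convex_real.2 hs.2
  have : ContinuousSMul ℝ X := IsScalarTower.continuousSMul ℂ
  have hw := with_gaugeSeminormFamily (𝕜 := ℂ) (E := X)
  exact (hw.tendsto_nhds u x).2 fun i ε hε => h _ (hw.continuous_seminorm i) ε hε

/-- A competing locally convex topology is determined by its continuous seminorms, whose pullbacks
to each `H_b(E_p)` are continuous; so it suffices that such seminorms be `τ_δ`-continuous. -/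
theorem induced_tauDelta_le_hubTopology (hub : hubSubmodule E = ⊤)
    (h : ∀ q : Seminorm ℂ (hubSubmodule E),
      (∀ p : {p : Seminorm ℂ E // Continuous p}, @Continuous _ _ (hbTopology _) _
        (q.comp (piStar p))) →
      IsDeltaContinuous (q.comp (LinearMap.id.codRestrict (hubSubmodule E) fun f => by simp [hub]))) :
    TopologicalSpace.induced Subtype.val (tauDelta E) ≤ hubTopology E := by
  refine le_sInf fun t ⟨ht1, ht2, ht3, ht4⟩ => ?_
  let t' := TopologicalSpace.induced (Subtype.val : hubSubmodule E → Holo E) (tauDelta E)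
  refine continuous_id_iff_le.1 ?_
  refine (@continuous_iff_continuousAt _ _ t' t _).2 fun y => ?_
  refine @tendsto_of_forall_continuous_seminorm _ _ _ _ t ht1 ht2 ht3 _ _ _ fun q hq ε hε => ?_
  have hδ := h q fun p => @Continuous.comp _ _ _ (hbTopology _) t _ _ _ hq (ht4 p)
  have hv : @Continuous _ _ t' (tauDelta E) (Subtype.val : hubSubmodule E → Holo E) :=
    continuous_induced_dom
  have := (@continuous_iff_topologyOfSeminorms _ _ _ _ t' _ _).1 hv y _ hδ ε hε
  exact this

end Inductive

/-! ### `H(ℂ^ℕ)` is the inductive limit of the spaces `H(ℂⁿ)` -/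

section Sequences

/-- The continuous seminorm `x ↦ ∑_{i < k} |xᵢ|` on `ℂ^ℕ`. -/
def headSeminorm (k : ℕ) : Seminorm ℂ (ℕ → ℂ) :=
  Seminorm.of (fun x => ∑ i ∈ Finset.range k, ‖x i‖)
    (fun x y => by
      rw [← Finset.sum_add_distrib]
      exact Finset.sum_le_sum fun i _ => norm_add_le _ _)
    (fun c x => by simp [Finset.mul_sum])

theorem headSeminorm_apply (k : ℕ) (x : ℕ → ℂ) :
    headSeminorm k x = ∑ i ∈ Finset.range k, ‖x i‖ := rfl

theorem continuous_headSeminorm (k : ℕ) : Continuous (headSeminorm k) := by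
  change Continuous fun x : ℕ → ℂ => ∑ i ∈ Finset.range k, ‖x i‖
  fun_prop

theorem piMap_headSeminorm_eq_iff {k : ℕ} {x y : ℕ → ℂ} :
    piMap (headSeminorm k) x = piMap (headSeminorm k) y ↔ ∀ i < k, x i = y i := by
  rw [← sub_eq_zero, ← map_sub, ← norm_eq_zero, norm_piMap, headSeminorm_apply,
    Finset.sum_eq_zero_iff_of_nonneg fun _ _ => norm_nonneg _]
  simp [sub_eq_zero]

instance finiteDimensional_normedQuot_headSeminorm (k : ℕ) :
    FiniteDimensional ℂ (NormedQuot (headSeminorm k)) := by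
  let ext : (Fin k → ℂ) →ₗ[ℂ] (ℕ → ℂ) :=
    LinearMap.pi fun i => if h : i < k then LinearMap.proj ⟨i, h⟩ else 0
  refine Module.Finite.of_surjective ((piMap (headSeminorm k)).comp ext) fun z => ?_
  obtain ⟨x, rfl⟩ := piMap_surjective _ z
  exact ⟨fun i => x i, piMap_headSeminorm_eq_iff.2 fun i hi => by simp [ext, hi]⟩

/-- A linear right inverse of `π_p`, continuous because `E_p` is finite-dimensional; recovering the
first `k` coordinates is enough for functions of those variables. -/
theorem exists_section_headSeminorm (k : ℕ) :
    ∃ s : NormedQuot (headSeminorm k) →ₗ[ℂ] (ℕ → ℂ), Continuous s ∧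
      ∀ x, ∀ i < k, s (piMap (headSeminorm k) x) i = x i := by
  obtain ⟨s, hs⟩ := (piMap (headSeminorm k)).exists_rightInverse_of_surjective
    (LinearMap.range_eq_top.2 (piMap_surjective _))
  refine ⟨s, s.continuous_of_finiteDimensional, fun x => piMap_headSeminorm_eq_iff.1 ?_⟩
  exact LinearMap.congr_fun hs (piMap (headSeminorm k) x)

/-- A holomorphic function of the first `k` variables as an element of `H_b(E_p)`. -/
def Holo.descend (f : Holo (ℕ → ℂ)) {k : ℕ} (s : NormedQuot (headSeminorm k) →ₗ[ℂ] (ℕ → ℂ))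
    (hs : Continuous s) : Hb (NormedQuot (headSeminorm k)) :=
  ⟨fun y => f.fn (s y), isBoundedType_of_mem_holoSubmodule ⟨f.continuous.comp hs, fun a b => by
    have h := f.2.2 (s a) (s b)
    simp only [map_add, map_smul]
    exact h⟩⟩

theorem piStar_descend {f : Holo (ℕ → ℂ)} {k : ℕ} (hf : DependsOnFirst k f.fn)
    {s : NormedQuot (headSeminorm k) →ₗ[ℂ] (ℕ → ℂ)} (hs : Continuous s)
    (h : ∀ x, ∀ i < k, s (piMap (headSeminorm k) x) i = x i) (x : ℕ → ℂ) :
    (f.descend s hs).fn (piMap (headSeminorm k) x) = f.fn x :=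
  hf _ _ (h x)

theorem hubSubmodule_eq_top : hubSubmodule (ℕ → ℂ) = ⊤ := by
  refine eq_top_iff.2 fun f _ => ?_
  obtain ⟨k, hk⟩ := exists_dependsOnFirst f.2
  obtain ⟨s, hs, h⟩ := exists_section_headSeminorm k
  exact ⟨headSeminorm k, continuous_headSeminorm k, f.descend s hs,
    fun x => (piStar_descend hk hs h x).symm⟩

theorem induced_tauDelta_eq_hubTopology :
    TopologicalSpace.induced Subtype.val (tauDelta (ℕ → ℂ)) = hubTopology (ℕ → ℂ) := by
  refine le_antisymm (induced_tauDelta_le_hubTopology hubSubmodule_eq_top fun q hq => ?_)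
    hubTopology_le_induced_tauDelta
  refine isDeltaContinuous_of_dependsOnFirst fun k => ?_
  obtain ⟨s, hs, h⟩ := exists_section_headSeminorm k
  obtain ⟨C, ρ, hC, hb⟩ := exists_le_hbSeminorm (hq ⟨headSeminorm k, continuous_headSeminorm k⟩)
  have := FiniteDimensional.proper ℂ (NormedQuot (headSeminorm k))
  -- The doubled radius and the factor `2` both come from `hbSeminorm_le`.
  refine ⟨s '' Metric.closedBall 0 (2 * ρ), (isCompact_closedBall _ _).image hs, C * 2,
    by positivity, fun f hf B hB hfB => ?_⟩
  have e : LinearMap.id.codRestrict (hubSubmodule (ℕ → ℂ)) (fun f => by simp [hubSubmodule_eq_top]) f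
      = piStar ⟨headSeminorm k, continuous_headSeminorm k⟩ (f.descend s hs) := by
    refine Subtype.ext (Holo.ext fun x => ?_)
    exact (piStar_descend hf hs h x).symm
  rw [Seminorm.comp_apply, e]
  refine (hb (f.descend s hs)).trans ?_
  rw [mul_assoc]
  refine mul_le_mul_of_nonneg_left (hbSeminorm_le ρ _ fun y hy => ?_) hC.le
  exact hfB _ (mem_image_of_mem s (by simpa using hy))

end Sequences

end HolC

end

theorem mainTheorem5 :
    (HolC.tauZero (ℕ → ℂ) = HolC.tauOmega (ℕ → ℂ) ∧
      HolC.tauOmega (ℕ → ℂ) ≠ HolC.tauDelta (ℕ → ℂ) ∧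
      HolC.hubSubmodule (ℕ → ℂ) = ⊤ ∧
      TopologicalSpace.induced Subtype.val (HolC.tauDelta (ℕ → ℂ)) =
        HolC.hubTopology (ℕ → ℂ)) ∧
    ∀ a : ℕ → ℂ,
      ∀ τ ∈ ({HolC.tauZero (ℕ → ℂ), HolC.tauOmega (ℕ → ℂ), HolC.tauDelta (ℕ → ℂ)} :
          Set (TopologicalSpace (HolC.Holo (ℕ → ℂ)))),
        HolC.IsConvolutionOperator τ (HolC.translation a) ∧
          ¬ HolC.IsHypercyclic τ (HolC.translation a) := by
  refine ⟨⟨HolC.tauZero_eq_tauOmega, HolC.tauZero_eq_tauOmega ▸ HolC.tauZero_ne_tauDelta,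
    HolC.hubSubmodule_eq_top, HolC.induced_tauDelta_eq_hubTopology⟩, fun a τ hτ => ?_⟩
  rw [← HolC.tauZero_eq_tauOmega, mem_insert_iff, mem_insert_iff, mem_singleton_iff] at hτ
  rcases hτ with rfl | rfl | rfl
  · exact ⟨⟨HolC.continuous_translation_tauZero a, fun b f => HolC.translation_comm a b f⟩,
      HolC.not_isHypercyclic_tauZero a⟩
  · exact ⟨⟨HolC.continuous_translation_tauZero a, fun b f => HolC.translation_comm a b f⟩,
      HolC.not_isHypercyclic_tauZero a⟩
  · exact ⟨⟨HolC.continuous_translation_tauDelta a, fun b f => HolC.translation_comm a b f⟩,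
      HolC.not_isHypercyclic_of_le (HolC.tauDelta_le_tauOmega.trans HolC.tauOmega_le_tauZero) a⟩
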